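/- Let $N,n,m\ge 0$ be integers, let $\Omega$ be a topological space of parameters and $\mathcal P\subseteq\Omega$. Let $f:\mathbb R^n\times\mathbb R^m\times\Omega\to\mathbb R^n$, fix a constant reference vector $r\in\mathbb R^m$, and suppose that for $\omega\in\mathcal P$ the map $x\mapsto f(x,r,\omega)$ is differentiable and that $(x,\omega)\mapsto f(x,r,\omega)$ and $(x,\omega)\mapsto \partial_x f(x,r,\omega)$ are continuous on $\mathbb R^n\times\mathcal P$. For neighbour sets $\mathcal N_i\subseteq\{1,\dots,N\}$ and gain matrices $\mathbf K_{ij}\in\mathbb R^{n\times n}$ consider, for $\omega=(\omega_1,\dots,\omega_N)$, the coupled oscillators $$\dot x_i=f(x_i,r,\omega_i)+\sum_{j\in\mathcal N_i}\mathbf K_{ij}(x_j-x_i),\qquad i=1,\dots,N,$$ and write them as $\dot x=F_\omega(x)$ with $x=(x_1,\dots,x_N)\in\mathbb R^{nN}$. Definitions. A set $K\subset\mathbb R^{nN}$ is *strictly forward invariant* under $F$ if $F$ points strictly into $K$ along $\partial K$: for every $x\in\partial K$ there is $\varepsilon>0$ such that $y+tv\in K$ whenever $y\in K$, $|y-x|<\varepsilon$,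 $|v-F(x)|<\varepsilon$ and $0<t<\varepsilon$. A *metric* on $K$ is a $C^1$ map $M$ from $K$ to the symmetric matrices that is uniformly positive definite on $K$. The system $\dot x=F(x)$ is *transverse contracting with rate $\lambda>0$ under $M$* on $K$ if $K$ is compact and strictly forward invariant, $M$ is a metric on $K$, and with $A=\partial F/\partial x$ and $\dot M$ the derivative of $M$ along $F$, $$\delta^{T}\bigl(\dot M+A^{T}M+MA+2\lambda M\bigr)\delta\le 0\quad\text{for all }x\in K\text{ and }\delta\neq0\text{ with }F(x)^{T}M(x)\delta=0 .$$ Proposition. Let $\omega_0\in\operatorname{int}\mathcal P$ and suppose that, when $\omega_i=\omega_0$ for all $i$, the coupled oscillators are transverse contracting with some rate $\lambda>0$ under a metric $M$ on a nonempty connected set $K$, and have no equilibrium in $K$. Then there are an open set $W\subseteq\mathcal P$ with $\omega_0\in W$ and a $\lambda'>0$ such that, whenever every $\omega_i\in W$, the following hold. 1. The heterogeneous coupled oscillators $\dot x=F_\omega(x)$ are transverse contracting on the same $K$, under the same metric $M$, with rate $\lambda'$, and have no equilibrium in $K$. From every point of $K$ there is a solution on $[0,\infty)$, and every solution that starts in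 $K$ lies in $\operatorname{int}K$ for all $t>0$. Any two solutions $x,y$ that start in $K$ converge to one another exponentially up to a monotonic reparameterization of time: there is $\mu>0$, independent of the solutions, such that for some constant $C$ and some strictly increasing continuous $\tau:[0,\infty)\to[0,\infty)$ with $\tau(0)=0$ and $\tau(t)\to\infty$ we have $|x(t)-y(\tau(t))|\le Ce^{-\mu t}$ for all $t\ge0$. 2. There is a unique limit cycle in $K$: there is a periodic orbit $\mathcal O\subset\operatorname{int}K$ (the orbit of a nonconstant periodic solution, with least period $T>0$ common to the whole network), it is the only periodic orbit contained in $K$, and every solution $x$ that starts in $K$ satisfies $\operatorname{dist}(x(t),\mathcal O)\to0$ as $t\to\infty$. -/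

import Mathlib

open Set Filter Topology

/-- `x` solves the autonomous equation `x' = f x` on `[0, ∞)`
(the derivative at time `0` is one-sided). -/
def IsForwardSolution {X : Type*} [NormedAddCommGroup X] [NormedSpace ℝ X]
    (f : X → X) (x : ℝ → X) : Prop :=
  IsIntegralCurveOn x (fun _ => f) (Ici 0)

/-- `K` is strictly forward invariant: at every boundary point `x` the vector field points
strictly into `K`, i.e. `f x` is interior to the cone of directions entering `K` at `x`:
short segments that start at points of `K` near `x`, in directions near `f x`, stay in `K`.
For `K` with smooth boundary and outer normal `ν` this says `⟪f x, ν x⟫ < 0` on the boundary. -/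
def StrictlyForwardInvariant {X : Type*} [NormedAddCommGroup X] [NormedSpace ℝ X]
    (f : X → X) (K : Set X) : Prop :=
  ∀ x ∈ frontier K, ∃ ε > 0, ∀ y ∈ K ∩ Metric.ball x ε, ∀ v ∈ Metric.ball (f x) ε,
    ∀ t ∈ Ioo (0 : ℝ) ε, y + t • v ∈ K

/-- A `C¹`, symmetric, uniformly positive definite metric on `K`; the matrix `M(x)` is written as
the bilinear form `(u, v) ↦ uᵀ M(x) v`. Only its values on `K` matter. -/
structure IsMetricOn {X : Type*} [NormedAddCommGroup X] [NormedSpace ℝ X]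
    (M : X → X →L[ℝ] X →L[ℝ] ℝ) (K : Set X) : Prop where
  contDiffOn : ContDiffOn ℝ 1 M K
  symm : ∀ x ∈ K, ∀ u v : X, M x u v = M x v u
  posDef : ∃ c > 0, ∀ x ∈ K, ∀ v : X, c * ‖v‖ ^ 2 ≤ M x v v

/-- `x' = f x` is transverse contracting with rate `lam` under the metric `M` on the compact,
strictly forward invariant region `K`:
`δᵀ (Ṁ + Aᵀ M + M A + 2 lam M) δ ≤ 0` whenever `f(x)ᵀ M(x) δ = 0`,
where `A = ∂f/∂x` and `Ṁ` is the derivative of `M` along the flow. -/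
structure TransverseContracting {X : Type*} [NormedAddCommGroup X] [NormedSpace ℝ X]
    (f : X → X) (K : Set X) (M : X → X →L[ℝ] X →L[ℝ] ℝ) (lam : ℝ) : Prop where
  isCompact : IsCompact K
  invariant : StrictlyForwardInvariant f K
  metric : IsMetricOn M K
  rate_pos : 0 < lam
  contraction : ∀ x ∈ K, ∀ δ : X, δ ≠ 0 → M x (f x) δ = 0 →
    fderivWithin ℝ M K x (f x) δ δ + M x (fderiv ℝ f x δ) δ + M x δ (fderiv ℝ f x δ)
      + 2 * lam * M x δ δ ≤ 0

/-- Any two solutions of `x' = f x` starting in `K` converge to one another exponentially, up to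
a monotonic reparameterization `τ` of time. -/
def ConvergeUpToReparam {X : Type*} [NormedAddCommGroup X] [NormedSpace ℝ X]
    (f : X → X) (K : Set X) : Prop :=
  ∃ μ > 0, ∀ x y : ℝ → X, IsForwardSolution f x → IsForwardSolution f y → x 0 ∈ K → y 0 ∈ K →
    ∃ (C : ℝ) (τ : ℝ → ℝ), τ 0 = 0 ∧ StrictMonoOn τ (Ici 0) ∧ ContinuousOn τ (Ici 0) ∧
      Tendsto τ atTop atTop ∧ ∀ t : ℝ, 0 ≤ t → ‖x t - y (τ t)‖ ≤ C * Real.exp (-μ * t)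

/-- `O` is the orbit of a periodic solution of `x' = f x` with least period `T > 0`;
in particular `O` is not a single equilibrium. -/
def IsPeriodicOrbit {X : Type*} [NormedAddCommGroup X] [NormedSpace ℝ X]
    (f : X → X) (O : Set X) (T : ℝ) : Prop :=
  0 < T ∧ ∃ γ : ℝ → X, IsIntegralCurve γ (fun _ => f) ∧ Function.Periodic γ T ∧
    (∀ S : ℝ, 0 < S → S < T → ¬ Function.Periodic γ S) ∧ range γ = O

/-- The stacked state `(x₁, …, x_N)` of `N` oscillators with states in `ℝⁿ`. -/
abbrev NetworkState (N n : ℕ) : Type :=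
  PiLp 2 (fun _ : Fin N => EuclideanSpace ℝ (Fin n))

/-- The coupled oscillators: the `i`-th component of the vector field is
`f(xᵢ, r, ωᵢ) + ∑ j ∈ 𝒩ᵢ, Gᵢⱼ (xⱼ - xᵢ)`. -/
noncomputable def coupledField {N n m : ℕ} {Ω : Type*}
    (f : EuclideanSpace ℝ (Fin n) → EuclideanSpace ℝ (Fin m) → Ω → EuclideanSpace ℝ (Fin n))
    (nbr : Fin N → Finset (Fin N)) (G : Fin N → Fin N → Matrix (Fin n) (Fin n) ℝ)
    (r : EuclideanSpace ℝ (Fin m)) (ω : Fin N → Ω) (x : NetworkState N n) : NetworkState N n :=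
  WithLp.toLp 2 fun i =>
    f (x i) r (ω i) + ∑ j ∈ nbr i, Matrix.toEuclideanCLM (𝕜 := ℝ) (G i j) (x j - x i)

/-!
Transverse contraction makes the field `F` contract every direction except its own, so two nearby
solutions approach one another as soon as their phases are aligned. The proof aligns the phases by
feedback instead of by a moving Poincaré section. Finsler's lemma
(`TransverseContracting.exists_penalty`) turns the contraction hypothesis, which concerns only
directions `δ` with `F(x)ᵀ M(x) δ = 0`, into the inequality
`δᵀ (Ṁ + Aᵀ M + M A) δ ≤ -lam δᵀ M δ + k (F(x)ᵀ M(x) δ)²` for every `δ`. If `y` is run in the time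
`τ` with `τ' = 1 - k F(x)ᵀ M(x) (y(τ) - x)`, the feedback contributes, to leading order in
`e = y(τ) - x`, a penalty `-2 k (F(x)ᵀ M(x) e)²` that absorbs the last term, and the squared
distance `eᵀ M(x) e` decreases exponentially as long as `e` is small, hence forever
(`TransverseContracting.exists_phaseTracks_of_near`). Since `τ' - 1` is then exponentially small,
`τ t - t` converges to a phase shift `θ`, which is small when the initial distance is.

Two consequences carry the theorem. First, in a connected region any two points are joined by a
chain of small steps, and tracking composes without loss of the rate, so all solutions
synchronize (`TransverseContracting.exists_phaseTracks`). Secondly, a solution in a compact region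
nearly returns to an earlier position; synchronizing it with its own translate shows that it is
exponentially close to its translate by some `T > 0`, so its translates by multiples of `T` converge
to a `T`-periodic solution, which is not constant because `F` has no zero. This gives the limit
cycle without a return map; attraction and uniqueness follow from the synchronization of all
solutions (`TransverseContracting.exists_unique_limitCycle`).

Robustness is a compactness argument: the boundary condition is stable under uniformly small
perturbations of `F` (`StrictlyForwardInvariant.exists_robust`), and the penalized inequality is
stable under perturbations that are small in `C¹` (`TransverseContracting.exists_robust`). For the
coupled oscillators the coupling terms are the same for all parameters, so such a perturbation
results from moving each `ω i` in a small neighbourhood of `ω₀`.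
-/

/-! ### Global solutions of bounded Lipschitz equations -/

/-- The Picard–Lindelöf theorem works on an interval of any prescribed length when the field is
globally bounded and globally Lipschitz. -/
theorem exists_solution_Icc_of_bounded_lipschitz {E : Type*} [NormedAddCommGroup E]
    [NormedSpace ℝ E] [CompleteSpace E] {v : ℝ → E → E} {L B : NNReal}
    (hv : ∀ t, LipschitzWith L (v t)) (hcont : ∀ x, Continuous fun t => v t x)
    (hB : ∀ t x, ‖v t x‖ ≤ B) (x₀ : E) (n : ℕ) :
    ∃ α : ℝ → E, α 0 = x₀ ∧
      ∀ t ∈ Icc (0 : ℝ) n, HasDerivWithinAt α (v t (α t)) (Icc (0 : ℝ) n) t := by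
  have h : IsPicardLindelof v (⟨0, by simp⟩ : Icc (0 : ℝ) n) x₀ (B * n) 0 B L :=
    { lipschitzOnWith := fun t _ => (hv t).lipschitzOnWith
      continuousOn := fun x _ => (hcont x).continuousOn
      norm_le := fun t _ x _ => hB t x
      mul_max_le := by simp }
  exact h.exists_eq_forall_mem_Icc_hasDerivWithinAt₀

theorem exists_isIntegralCurveOn_Ici_of_bounded_lipschitz {E : Type*} [NormedAddCommGroup E]
    [NormedSpace ℝ E] [CompleteSpace E] {v : ℝ → E → E} {L B : NNReal}
    (hv : ∀ t, LipschitzWith L (v t)) (hcont : ∀ x, Continuous fun t => v t x)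
    (hB : ∀ t x, ‖v t x‖ ≤ B) (x₀ : E) :
    ∃ x : ℝ → E, x 0 = x₀ ∧ IsIntegralCurveOn x v (Ici 0) := by
  choose α hα0 hα using exists_solution_Icc_of_bounded_lipschitz hv hcont hB x₀
  have key : ∀ m n : ℕ, m ≤ n → EqOn (α m) (α n) (Icc (0 : ℝ) m) := by
    intro m n hmn
    have hmn' : (m : ℝ) ≤ n := by exact_mod_cast hmn
    have hder : ∀ k : ℕ, m ≤ k → ∀ t ∈ Ico (0 : ℝ) m,
        HasDerivWithinAt (α k) (v t (α k t)) (Ici t) t := by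
      intro k hk t ht
      have hk' : (m : ℝ) ≤ k := by exact_mod_cast hk
      exact (hα k t ⟨ht.1, ht.2.le.trans hk'⟩).mono_of_mem_nhdsWithin
        (Icc_mem_nhdsGE_of_mem ⟨ht.1, ht.2.trans_le hk'⟩)
    refine ODE_solution_unique hv (fun t ht => (hα m t ht).continuousWithinAt) (hder m le_rfl)
      (fun t ht => ?_) (hder n hmn) (by rw [hα0, hα0])
    exact ((hα n t ⟨ht.1, ht.2.trans hmn'⟩).mono (Icc_subset_Icc_right hmn')).continuousWithinAt
  set x : ℝ → E := fun t => α (⌈t⌉₊) t with hx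
  have hxeq : ∀ n : ℕ, EqOn x (α n) (Icc (0 : ℝ) n) := fun n t ht =>
    key _ n (Nat.ceil_le.2 ht.2) ⟨ht.1, Nat.le_ceil t⟩
  refine ⟨x, by simp [hx, hα0], fun t (ht : 0 ≤ t) => ?_⟩
  obtain ⟨n, hn⟩ := exists_nat_gt t
  have h1 := (hα n t ⟨ht, hn.le⟩).congr_of_mem (hxeq n) ⟨ht, hn.le⟩
  rw [← hxeq n ⟨ht, hn.le⟩] at h1
  refine h1.mono_of_mem_nhdsWithin ?_
  have : Icc (0 : ℝ) n = Ici 0 ∩ Iic (n : ℝ) := rfl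
  rw [this]
  exact inter_mem self_mem_nhdsWithin (mem_nhdsWithin_of_mem_nhds (Iic_mem_nhds hn))

/-! ### Strictly forward invariant regions -/

section Invariant

variable {X : Type*} [NormedAddCommGroup X] [NormedSpace ℝ X] {F : X → X} {K : Set X} {x : ℝ → X}

theorem IsForwardSolution.continuousOn (hx : IsForwardSolution F x) : ContinuousOn x (Ici 0) :=
  IsIntegralCurveOn.continuousOn hx

theorem IsForwardSolution.hasDerivWithinAt_Ici (hx : IsForwardSolution F x) {t : ℝ} (ht : 0 ≤ t) :
    HasDerivWithinAt x (F (x t)) (Ici t) t :=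
  (hx t ht).mono (Ici_subset_Ici.2 ht)

theorem IsForwardSolution.hasDerivAt (hx : IsForwardSolution F x) {t : ℝ} (ht : 0 < t) :
    HasDerivAt x (F (x t)) t :=
  (hx t ht.le).hasDerivAt (Ici_mem_nhds ht)

theorem IsForwardSolution.comp_add (hx : IsForwardSolution F x) {a : ℝ} (ha : 0 ≤ a) :
    IsForwardSolution F fun t => x (t + a) := by
  intro t (ht : 0 ≤ t)
  have h := hx (t + a) (by positivity : (0 : ℝ) ≤ t + a)
  have h2 := h.scomp t (h' := 1) ((hasDerivAt_id t).add_const a).hasDerivWithinAt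
    (s := Ici 0) (fun s (hs : 0 ≤ s) => add_nonneg hs ha)
  simpa [Function.comp_def] using h2

/-- If the directions within `ε` of `F z` enter `K` from `y`, then so does the whole open ball of
endpoints `y + h • v`, so an endpoint of this kind is interior to `K`. -/
theorem add_smul_mem_interior {y w : X} {ε h : ℝ} (hh : 0 < h)
    (hcone : ∀ v ∈ Metric.ball w ε, y + h • v ∈ K) {v : X} (hv : v ∈ Metric.ball w ε) :
    y + h • v ∈ interior K := by
  have hopen : IsOpen ((fun z => h⁻¹ • (z - y)) ⁻¹' Metric.ball w ε) :=
    Metric.isOpen_ball.preimage (by fun_prop)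
  refine mem_interior.2 ⟨_, fun z hz => ?_, hopen, ?_⟩
  · have := hcone _ hz
    simpa [smul_smul, hh.ne'] using this
  · simpa [smul_smul, hh.ne'] using hv

/-- A solution is in the interior of `K` immediately after every time at which it is in `K`. -/
theorem IsForwardSolution.eventually_mem_interior (hinv : StrictlyForwardInvariant F K)
    (hx : IsForwardSolution F x) {t : ℝ} (ht : 0 ≤ t) (hxt : x t ∈ K) :
    ∀ᶠ s in 𝓝[>] t, x s ∈ interior K := by
  have hder := (hx.hasDerivWithinAt_Ici ht).mono Ioi_subset_Ici_self
  by_cases hint : x t ∈ interior K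
  · exact hder.continuousWithinAt.eventually (isOpen_interior.mem_nhds hint)
  obtain ⟨ε, hε, hcone⟩ := hinv (x t) ⟨subset_closure hxt, hint⟩
  have hslope := (hasDerivWithinAt_iff_tendsto_slope' self_notMem_Ioi).1 hder
  filter_upwards [hslope.eventually (Metric.ball_mem_nhds _ hε), Ioo_mem_nhdsGT (show t < t + ε by
    linarith)] with s hs hst
  have h := add_smul_mem_interior (h := s - t) (by linarith [hst.1])
    (fun v hv => hcone (x t) ⟨hxt, Metric.mem_ball_self hε⟩ v hv (s - t)
      ⟨by linarith [hst.1], by linarith [hst.2]⟩) hs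
  rwa [sub_smul_slope, vsub_eq_sub, add_sub_cancel] at h

theorem IsForwardSolution.mem_of_mem (hinv : StrictlyForwardInvariant F K) (hK : IsClosed K)
    (hx : IsForwardSolution F x) (h0 : x 0 ∈ K) {t : ℝ} (ht : 0 ≤ t) : x t ∈ K := by
  have hcl : IsClosed ({s | x s ∈ K} ∩ Icc 0 t) := by
    rw [inter_comm]
    exact (hx.continuousOn.mono Icc_subset_Ici_self).preimage_isClosed_of_isClosed isClosed_Icc hK
  refine hcl.Icc_subset_of_forall_mem_nhdsWithin h0 (fun s hs => ?_) (right_mem_Icc.2 ht)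
  filter_upwards [hx.eventually_mem_interior hinv hs.2.1 hs.1] with u hu using interior_subset hu

theorem IsForwardSolution.mem_interior_of_pos (hinv : StrictlyForwardInvariant F K)
    (hK : IsClosed K) (hx : IsForwardSolution F x) (h0 : x 0 ∈ K) {t : ℝ} (ht : 0 < t) :
    x t ∈ interior K := by
  by_contra hint
  have hxt := hx.mem_of_mem hinv hK h0 ht.le
  obtain ⟨ε, hε, hcone⟩ := hinv (x t) ⟨subset_closure hxt, hint⟩
  -- Look back from time `t`: `x t` is reached from an earlier point of `K` in a direction near
  -- `F (x t)`.
  have hder := (hx.hasDerivAt ht).hasDerivWithinAt (s := Iio t)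
  have hslope := (hasDerivWithinAt_iff_tendsto_slope' self_notMem_Iio).1 hder
  have hnear := hder.continuousWithinAt.eventually (Metric.ball_mem_nhds _ hε)
  have hclose : ∀ᶠ s in 𝓝[<] t, s ∈ Ioo (t - ε) t := Ioo_mem_nhdsLT (by linarith)
  have hpos : ∀ᶠ s in 𝓝[<] t, s ∈ Ioo 0 t := Ioo_mem_nhdsLT ht
  obtain ⟨s, hs, hsb, hst, hs0⟩ := ((hslope.eventually (Metric.ball_mem_nhds _ hε)).and
    (hnear.and (hclose.and hpos))).exists
  have h := add_smul_mem_interior (h := t - s) (by linarith [hst.2])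
    (fun v hv => hcone (x s) ⟨hx.mem_of_mem hinv hK h0 hs0.1.le, hsb⟩ v hv (t - s)
      ⟨by linarith [hst.2], by linarith [hst.1]⟩) hs
  rw [slope_comm, sub_smul_slope, vsub_eq_sub, add_sub_cancel] at h
  exact hint h

/-- Every tangent cone to a strictly forward invariant region contains a ball around a multiple of
the field, so derivatives within the region are unique. -/
theorem StrictlyForwardInvariant.uniqueDiffOn (hinv : StrictlyForwardInvariant F K) :
    UniqueDiffOn ℝ K := by
  intro x hxK
  by_cases hint : x ∈ interior K
  · exact uniqueDiffWithinAt_of_mem_nhds (mem_interior_iff_mem_nhds.1 hint)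
  obtain ⟨ε, hε, hcone⟩ := hinv x ⟨subset_closure hxK, hint⟩
  have hsub : Metric.ball (F x) ε ⊆ (Submodule.span ℝ (tangentConeAt ℝ K x) : Set X) := by
    intro v hv
    have hmem : (ε / 2) • v ∈ tangentConeAt ℝ K x := by
      have := mem_tangentConeAt_of_openSegment_subset (s := K) (x := x) (y := x + (ε / 2) • v) ?_
      · simpa using this
      · rw [openSegment_eq_image']
        rintro _ ⟨θ, hθ, rfl⟩
        have := hcone x ⟨hxK, Metric.mem_ball_self hε⟩ v hv (θ * (ε / 2))
          ⟨by nlinarith [hθ.1], by nlinarith [hθ.1, hθ.2]⟩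
        simpa [smul_smul] using this
    have := Submodule.smul_mem _ (ε / 2)⁻¹ (Submodule.subset_span (R := ℝ) hmem)
    simpa [smul_smul, hε.ne'] using this
  have htop := Submodule.eq_top_of_nonempty_interior' (Submodule.span ℝ (tangentConeAt ℝ K x))
    ⟨F x, mem_interior.2 ⟨_, hsub, Metric.isOpen_ball, Metric.mem_ball_self hε⟩⟩
  exact ⟨by rw [htop]; exact dense_univ, subset_closure hxK⟩

/-- On a compact region strict forward invariance persists under uniformly small perturbations of
the field. -/
theorem StrictlyForwardInvariant.exists_robust (hinv : StrictlyForwardInvariant F K)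
    (hK : IsCompact K) (hF : Continuous F) :
    ∃ ε > 0, ∀ G : X → X, (∀ x ∈ K, ‖G x - F x‖ ≤ ε) → StrictlyForwardInvariant G K := by
  have hfK : frontier K ⊆ K := hK.isClosed.frontier_subset
  have hfc : IsCompact (frontier K) := hK.of_isClosed_subset isClosed_frontier hfK
  have key : ∃ ε > 0, ∀ z ∈ frontier K, ∀ y ∈ K ∩ Metric.ball z ε, ∀ v ∈ Metric.ball (F z) ε,
      ∀ t ∈ Ioo (0 : ℝ) ε, y + t • v ∈ K := by
    refine hfc.induction_on (p := fun s => ∃ ε > 0, ∀ z ∈ s, ∀ y ∈ K ∩ Metric.ball z ε,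
      ∀ v ∈ Metric.ball (F z) ε, ∀ t ∈ Ioo (0 : ℝ) ε, y + t • v ∈ K) ⟨1, one_pos, by simp⟩ ?_ ?_ ?_
    · rintro s t hst ⟨ε, hε, h⟩
      exact ⟨ε, hε, fun z hz => h z (hst hz)⟩
    · rintro s t ⟨ε, hε, h⟩ ⟨ε', hε', h'⟩
      refine ⟨min ε ε', lt_min hε hε', ?_⟩
      rintro z (hz | hz) y ⟨hy, hyz⟩ v hv τ hτ
      · exact h z hz y ⟨hy, Metric.ball_subset_ball (min_le_left _ _) hyz⟩ v
          (Metric.ball_subset_ball (min_le_left _ _) hv) τ ⟨hτ.1, hτ.2.trans_le (min_le_left _ _)⟩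
      · exact h' z hz y ⟨hy, Metric.ball_subset_ball (min_le_right _ _) hyz⟩ v
          (Metric.ball_subset_ball (min_le_right _ _) hv) τ
          ⟨hτ.1, hτ.2.trans_le (min_le_right _ _)⟩
    · intro x hx
      obtain ⟨ε, hε, h⟩ := hinv x hx
      have hε2 : 0 < ε / 2 := by positivity
      refine ⟨Metric.ball x (ε / 2) ∩ F ⁻¹' Metric.ball (F x) (ε / 2), mem_nhdsWithin_of_mem_nhds
        (inter_mem (Metric.ball_mem_nhds _ hε2)
          (hF.continuousAt.preimage_mem_nhds (Metric.ball_mem_nhds _ hε2))), ε / 2, hε2, ?_⟩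
      rintro z ⟨hz, hFz⟩ y ⟨hy, hyz⟩ v hv τ hτ
      refine h y ⟨hy, ?_⟩ v ?_ τ ⟨hτ.1, by linarith [hτ.2]⟩
      · rw [Metric.mem_ball] at *
        linarith [dist_triangle y z x]
      · rw [mem_preimage] at hFz
        rw [Metric.mem_ball] at *
        linarith [dist_triangle v (F z) (F x)]
  obtain ⟨ε, hε, h⟩ := key
  refine ⟨ε / 2, by positivity, fun G hG z hz => ⟨ε / 2, by positivity, ?_⟩⟩
  rintro y ⟨hy, hyz⟩ v hv τ hτ
  refine h z hz y ⟨hy, Metric.ball_subset_ball (by linarith) hyz⟩ v ?_ τ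
    ⟨hτ.1, by linarith [hτ.2]⟩
  have := hG z (hfK hz)
  rw [← dist_eq_norm] at this
  rw [Metric.mem_ball] at *
  linarith [dist_triangle v (G z) (F z)]

/-- A solution exists from each point of a compact strictly forward invariant region: cut the field
off outside a ball around the region; the solution of the cut-off equation never leaves the
region. -/
theorem StrictlyForwardInvariant.exists_isForwardSolution [FiniteDimensional ℝ X]
    (hinv : StrictlyForwardInvariant F K) (hK : IsCompact K) (hF : ContDiff ℝ 1 F) {x₀ : X}
    (hx₀ : x₀ ∈ K) : ∃ x : ℝ → X, IsForwardSolution F x ∧ x 0 = x₀ := by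
  have : CompleteSpace X := FiniteDimensional.complete ℝ X
  obtain ⟨R, hR⟩ := hK.isBounded.subset_ball (0 : X)
  have hR' : K ⊆ Metric.closedBall 0 (max R 1) :=
    hR.trans (Metric.ball_subset_closedBall.trans (Metric.closedBall_subset_closedBall
      (le_max_left _ _)))
  let χ : ContDiffBump (0 : X) := ⟨max R 1, max R 1 + 1, by positivity, by linarith⟩
  set G : X → X := fun x => χ x • F x with hG
  have hGF : ∀ x ∈ K, G x = F x := fun x hx => by
    simp [hG, χ.one_of_mem_closedBall (hR' hx)]
  have hGd : ContDiff ℝ 1 G := χ.contDiff.smul hF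
  have hGs : HasCompactSupport G := χ.hasCompactSupport.smul_right
  obtain ⟨L, hL⟩ := hGd.lipschitzWith_of_hasCompactSupport hGs one_ne_zero
  obtain ⟨B, hB⟩ := hGs.exists_bound_of_continuous hGd.continuous
  obtain ⟨x, hx0, hx⟩ := exists_isIntegralCurveOn_Ici_of_bounded_lipschitz (v := fun _ => G)
    (B := B.toNNReal) (fun _ => hL) (fun _ => continuous_const)
    (fun _ y => (hB y).trans (Real.le_coe_toNNReal B)) x₀
  have hinvG : StrictlyForwardInvariant G K := fun z hz => by
    rw [hGF z (hK.isClosed.frontier_subset hz)]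
    exact hinv z hz
  have hxG : IsForwardSolution G x := hx
  refine ⟨x, fun t ht => ?_, hx0⟩
  have : HasDerivWithinAt x (G (x t)) (Ici 0) t := hx t ht
  rwa [hGF _ (hxG.mem_of_mem hinvG hK.isClosed (hx0 ▸ hx₀) ht)] at this

end Invariant

/-! ### Transverse contraction as a penalized inequality, and its robustness -/

/-- The compactness argument behind Finsler's lemma: a function that is negative where the
nonnegative function `g` vanishes is dominated by a multiple of `g`. -/
theorem IsCompact.exists_le_mul_of_neg {S : Type*} [TopologicalSpace S] {s : Set S}
    (hs : IsCompact s) {q g : S → ℝ} (hq : ContinuousOn q s) (hg : ContinuousOn g s)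
    (hg0 : ∀ x ∈ s, 0 ≤ g x) (hneg : ∀ x ∈ s, g x = 0 → q x < 0) :
    ∃ k, 0 ≤ k ∧ ∀ x ∈ s, q x ≤ k * g x := by
  obtain ⟨B, hB⟩ := hs.exists_bound_of_continuousOn hq
  -- Off the set `Z` where `q` is nonnegative there is nothing to prove; on `Z`, `g` is bounded
  -- away from zero.
  set Z := {x | x ∈ s ∧ 0 ≤ q x} with hZ
  have hZc : IsCompact Z := by
    have hsc := isCompact_iff_compactSpace.1 hs
    have hcl : IsClosed {x : s | 0 ≤ q x} :=
      isClosed_le continuous_const (continuousOn_iff_continuous_domRestrict.1 hq)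
    have := hcl.isCompact.image continuous_subtype_val
    convert this using 1
    ext x
    simp [hZ, and_comm]
  rcases Z.eq_empty_or_nonempty with hE | hne
  · refine ⟨0, le_rfl, fun x hx => ?_⟩
    by_contra! h
    have : x ∈ Z := ⟨hx, by linarith⟩
    simp [hE] at this
  · obtain ⟨z, hz, hmin⟩ := hZc.exists_isMinOn hne (hg.mono fun x hx => hx.1)
    have hgz : 0 < g z := lt_of_le_of_ne (hg0 z hz.1) fun h =>
      (hneg z hz.1 h.symm).not_ge hz.2
    have hB0 : 0 ≤ B := (norm_nonneg _).trans (hB z hz.1)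
    refine ⟨B / g z, by positivity, fun x hx => ?_⟩
    by_cases hqx : 0 ≤ q x
    · have h1 : g z ≤ g x := hmin ⟨hx, hqx⟩
      calc q x ≤ B := (le_abs_self _).trans (hB x hx)
        _ = B / g z * g z := by field_simp
        _ ≤ B / g z * g x := by gcongr
    · have := mul_nonneg (div_nonneg hB0 hgz.le) (hg0 x hx)
      linarith

section Contraction

-- Instances on iterated spaces of continuous linear maps are not found at the default depth.
set_option maxSynthPendingDepth 3

variable {X : Type*} [NormedAddCommGroup X] [NormedSpace ℝ X]

/-- The quadratic form `δᵀ (Ṁ + Aᵀ M + M A) δ` of the linearization `A` of the field `F` at `x`,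
which is the derivative of `δᵀ M δ` along solutions of the variational equation `δ' = A δ`. -/
noncomputable def metricRate (F : X → X) (K : Set X) (M : X → X →L[ℝ] X →L[ℝ] ℝ) (x δ : X) : ℝ :=
  fderivWithin ℝ M K x (F x) δ δ + M x (fderiv ℝ F x δ) δ + M x δ (fderiv ℝ F x δ)

variable {F : X → X} {K : Set X} {M : X → X →L[ℝ] X →L[ℝ] ℝ} {lam : ℝ}

/-- Finsler's lemma for transverse contraction: half of the contraction rate survives for *all*
directions `δ`, once a multiple of `(F(x)ᵀ M(x) δ)²` is allowed for. -/
theorem TransverseContracting.exists_penalty [FiniteDimensional ℝ X]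
    (h : TransverseContracting F K M lam) (hF : ContDiff ℝ 1 F) :
    ∃ k, 0 ≤ k ∧ ∀ x ∈ K, ∀ δ : X,
      metricRate F K M x δ ≤ -lam * M x δ δ + k * (M x (F x) δ) ^ 2 := by
  have hud := h.invariant.uniqueDiffOn
  have hM : ContinuousOn M K := h.metric.contDiffOn.continuousOn
  have hDM : ContinuousOn (fderivWithin ℝ M K) K :=
    h.metric.contDiffOn.continuousOn_fderivWithin hud le_rfl
  have hA : Continuous (fderiv ℝ F) := hF.continuous_fderiv one_ne_zero
  have hFc := hF.continuous
  obtain ⟨c, hc, hpos⟩ := h.metric.posDef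
  set S : Set (X × X) := K ×ˢ Metric.sphere 0 1
  have hS : IsCompact S := h.isCompact.prod (isCompact_sphere 0 1)
  have hM' : ContinuousOn (fun p : X × X => M p.1) S := hM.comp continuousOn_fst fun p hp => hp.1
  have hDM' : ContinuousOn (fun p : X × X => fderivWithin ℝ M K p.1) S :=
    hDM.comp continuousOn_fst fun p hp => hp.1
  have hF' : ContinuousOn (fun p : X × X => F p.1) S := (hFc.comp continuous_fst).continuousOn
  have hA' : ContinuousOn (fun p : X × X => fderiv ℝ F p.1) S :=
    (hA.comp continuous_fst).continuousOn
  have hδ : ContinuousOn (fun p : X × X => p.2) S := continuousOn_snd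
  obtain ⟨k, hk, hle⟩ := hS.exists_le_mul_of_neg
    (q := fun p => metricRate F K M p.1 p.2 + lam * M p.1 p.2 p.2)
    (g := fun p => (M p.1 (F p.1) p.2) ^ 2)
    (by
      unfold metricRate
      exact ((((hDM'.clm_apply hF').clm_apply hδ).clm_apply hδ).add
        ((hM'.clm_apply (hA'.clm_apply hδ)).clm_apply hδ) |>.add
        ((hM'.clm_apply hδ).clm_apply (hA'.clm_apply hδ))).add
        (continuousOn_const.mul ((hM'.clm_apply hδ).clm_apply hδ)))
    (((hM'.clm_apply hF').clm_apply hδ).pow 2)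
    (fun p _ => sq_nonneg _)
    (by
      rintro ⟨x, δ⟩ ⟨hx, hδ1⟩ h0
      have hn : ‖δ‖ = 1 := by simpa using hδ1
      have h1 := h.contraction x hx δ (by rintro rfl; simp at hn) (by simpa using h0)
      have h2 := hpos x hx δ
      have h3 : 0 < M x δ δ := by rw [hn] at h2; linarith
      have h4 := mul_pos h.rate_pos h3
      simp only [metricRate]
      linarith)
  refine ⟨k, hk, fun x hx δ => ?_⟩
  rcases eq_or_ne δ 0 with rfl | hδ0
  · simp [metricRate]
  have hn : ‖δ‖ ≠ 0 := norm_ne_zero_iff.2 hδ0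
  have h1 := hle (x, ‖δ‖⁻¹ • δ) ⟨hx, by simp [norm_smul, hn]⟩
  have h2 := mul_le_mul_of_nonneg_left h1 (sq_nonneg ‖δ‖)
  simp only [metricRate, map_smul, smul_apply, smul_eq_mul] at h2 ⊢
  have h3 : ‖δ‖ ^ 2 * (‖δ‖⁻¹ * ‖δ‖⁻¹) = 1 := by field_simp
  generalize fderivWithin ℝ M K x (F x) δ δ = a₁ at h2 ⊢
  generalize M x (fderiv ℝ F x δ) δ = a₂ at h2 ⊢
  generalize M x δ (fderiv ℝ F x δ) = a₃ at h2 ⊢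
  generalize M x δ δ = a₄ at h2 ⊢
  generalize M x (F x) δ = a₅ at h2 ⊢
  linear_combination h2 - (a₁ + a₂ + a₃ + lam * a₄ - k * a₅ ^ 2) * h3

/-- `C¹`-small perturbations of the field on the region preserve transverse contraction under the
same metric. -/
theorem TransverseContracting.exists_robust [FiniteDimensional ℝ X]
    (h : TransverseContracting F K M lam) (hF : ContDiff ℝ 1 F) :
    ∃ ε > 0, ∀ G : X → X, (∀ x ∈ K, ‖G x - F x‖ ≤ ε) →
      (∀ x ∈ K, ‖fderiv ℝ G x - fderiv ℝ F x‖ ≤ ε) → TransverseContracting G K M (lam / 4) := by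
  obtain ⟨k, hk, hpen⟩ := h.exists_penalty hF
  obtain ⟨ε₀, hε₀, hinv⟩ := h.invariant.exists_robust h.isCompact hF.continuous
  obtain ⟨c, hc, hpos⟩ := h.metric.posDef
  have hlam := h.rate_pos
  obtain ⟨Cm, hCm⟩ := h.isCompact.exists_bound_of_continuousOn h.metric.contDiffOn.continuousOn
  obtain ⟨Cd, hCd⟩ := h.isCompact.exists_bound_of_continuousOn
    (h.metric.contDiffOn.continuousOn_fderivWithin h.invariant.uniqueDiffOn le_rfl)
  set D : ℝ := |Cd| + 2 * |Cm| + k * |Cm| ^ 2 + 1 with hD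
  have hDpos : 0 < D := by positivity
  refine ⟨min ε₀ (min 1 (lam * c / 2 / D)), by positivity, fun G hG hG' =>
    ⟨h.isCompact, hinv G fun x hx => (hG x hx).trans (min_le_left _ _), h.metric, by positivity,
      fun x hx δ _ h0 => ?_⟩⟩
  set ε := min ε₀ (min 1 (lam * c / 2 / D)) with hε
  have hεpos : 0 < ε := by positivity
  have hε1 : ε ≤ 1 := (min_le_right _ _).trans (min_le_left _ _)
  have hεD : ε * D ≤ lam * c / 2 := by
    rw [← le_div_iff₀ hDpos]
    exact (min_le_right _ _).trans (min_le_right _ _)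
  set u := G x - F x with hu
  set B := fderiv ℝ G x - fderiv ℝ F x with hB
  have hGx : G x = F x + u := by simp [hu]
  have hGx' : fderiv ℝ G x = fderiv ℝ F x + B := by simp [hB]
  have hun : ‖u‖ ≤ ε := hG x hx
  have hBn : ‖B‖ ≤ ε := hG' x hx
  have hMn : ‖M x‖ ≤ |Cm| := (hCm x hx).trans (le_abs_self _)
  have hDn : ‖fderivWithin ℝ M K x‖ ≤ |Cd| := (hCd x hx).trans (le_abs_self _)
  have hBδ : ‖B δ‖ ≤ ε * ‖δ‖ := B.le_of_opNorm_le hBn δ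
  have hM2 : ∀ v w : X, |M x v w| ≤ |Cm| * ‖v‖ * ‖w‖ := fun v w =>
    ((M x).le_opNorm₂ v w).trans (by gcongr)
  have e1 : fderivWithin ℝ M K x u δ δ ≤ |Cd| * ε * ‖δ‖ * ‖δ‖ := by
    refine (le_abs_self _).trans (((fderivWithin ℝ M K x u).le_opNorm₂ δ δ).trans ?_)
    have := (fderivWithin ℝ M K x).le_of_opNorm_le_of_le hDn hun
    gcongr
  have e2 : M x (B δ) δ ≤ |Cm| * (ε * ‖δ‖) * ‖δ‖ :=
    (le_abs_self _).trans ((hM2 _ _).trans (by gcongr))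
  have e3 : M x δ (B δ) ≤ |Cm| * ‖δ‖ * (ε * ‖δ‖) :=
    (le_abs_self _).trans ((hM2 _ _).trans (by gcongr))
  have e4 : (M x (F x) δ) ^ 2 ≤ |Cm| ^ 2 * ε * ‖δ‖ ^ 2 := by
    have h1 : M x (F x) δ = - M x u δ := by
      have := h0
      rw [hGx, map_add, add_apply] at this
      linarith
    have h2 : |M x u δ| ≤ |Cm| * ε * ‖δ‖ := (hM2 _ _).trans (by gcongr)
    rw [h1, neg_sq, ← sq_abs]
    calc |M x u δ| ^ 2 ≤ (|Cm| * ε * ‖δ‖) ^ 2 := by gcongr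
      _ = |Cm| ^ 2 * (ε * ε) * ‖δ‖ ^ 2 := by ring
      _ ≤ |Cm| ^ 2 * (ε * 1) * ‖δ‖ ^ 2 := by gcongr
      _ = _ := by ring
  have e5 := hpen x hx δ
  have e6 := mul_le_mul_of_nonneg_right hεD (sq_nonneg ‖δ‖)
  have e7 := mul_le_mul_of_nonneg_left (hpos x hx δ) (half_pos hlam).le
  have e8 := mul_le_mul_of_nonneg_left e4 hk
  have e9 : 0 ≤ ε * ‖δ‖ ^ 2 := by positivity
  rw [hGx, hGx']
  simp only [metricRate, map_add, add_apply] at e5 ⊢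
  rw [hD] at e6
  nlinarith [e1, e2, e3, e5, e6, e7, e8, e9]

end Contraction

/-! ### Exponential synchronization of nearby solutions -/

/-- A function on `[0, ∞)` with exponentially small derivative converges exponentially. -/
theorem exists_abs_sub_le_exp_of_deriv_le {σ σ' : ℝ → ℝ} {D μ : ℝ} (hμ : 0 < μ)
    (hσ : ∀ t, 0 ≤ t → HasDerivWithinAt σ (σ' t) (Ici 0) t)
    (hb : ∀ t, 0 ≤ t → |σ' t| ≤ D * Real.exp (-μ * t)) :
    ∃ θ, ∀ t, 0 ≤ t → |σ t - θ| ≤ D / μ * Real.exp (-μ * t) := by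
  have hexp : ∀ t, HasDerivAt (fun t => D / μ * Real.exp (-μ * t)) (-(D * Real.exp (-μ * t))) t :=
    fun t => by
      have := (((hasDerivAt_id' t).const_mul (-μ)).exp).const_mul (D / μ)
      exact this.congr_deriv (by field_simp)
  have hcont : ContinuousOn σ (Ici 0) := fun t ht => (hσ t ht).continuousWithinAt
  have hcont' : ContinuousOn (fun t => D / μ * Real.exp (-μ * t)) (Ici 0) := by fun_prop
  have hint : ∀ t ∈ interior (Ici (0 : ℝ)), HasDerivAt σ (σ' t) t := fun t ht => by
    rw [interior_Ici] at ht
    exact (hσ t (le_of_lt ht)).hasDerivAt (Ici_mem_nhds ht)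
  -- The upper envelope decreases, the lower one increases, and `θ` separates them.
  have hanti : AntitoneOn (fun t => σ t + D / μ * Real.exp (-μ * t)) (Ici 0) := by
    refine antitoneOn_of_hasDerivWithinAt_nonpos (convex_Ici 0) (hcont.add hcont')
      (fun t ht => ((hint t ht).add (hexp t)).hasDerivWithinAt) fun t ht => ?_
    have := (abs_le.1 (hb t (interior_subset ht))).2
    linarith
  have hmono : MonotoneOn (fun t => σ t - D / μ * Real.exp (-μ * t)) (Ici 0) := by
    refine monotoneOn_of_hasDerivWithinAt_nonneg (convex_Ici 0) (hcont.sub hcont')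
      (fun t ht => ((hint t ht).sub (hexp t)).hasDerivWithinAt) fun t ht => ?_
    have := (abs_le.1 (hb t (interior_subset ht))).1
    linarith
  have hD : 0 ≤ D := by
    have := (abs_nonneg _).trans (hb 0 le_rfl)
    simpa using this
  have hle : ∀ s t, 0 ≤ s → 0 ≤ t → σ s - D / μ * Real.exp (-μ * s) ≤
      σ t + D / μ * Real.exp (-μ * t) := fun s t hs ht => by
    have h1 := hmono hs (hs.trans (le_max_left s t)) (le_max_left s t)
    have h2 := hanti ht (ht.trans (le_max_right s t)) (le_max_right s t)
    have h3 : 0 ≤ D / μ * Real.exp (-μ * max s t) := by positivity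
    dsimp only at h1 h2
    linarith
  set A := (fun t => σ t - D / μ * Real.exp (-μ * t)) '' Ici 0
  have hne : A.Nonempty := ⟨_, mem_image_of_mem _ self_mem_Ici⟩
  refine ⟨sSup A, fun t ht => ?_⟩
  have h1 : σ t - D / μ * Real.exp (-μ * t) ≤ sSup A :=
    le_csSup ⟨σ 0 + D / μ * Real.exp (-μ * 0), by
      rintro _ ⟨s, hs, rfl⟩; exact hle s 0 hs le_rfl⟩ (mem_image_of_mem _ ht)
  have h2 : sSup A ≤ σ t + D / μ * Real.exp (-μ * t) :=
    csSup_le hne (by rintro _ ⟨s, hs, rfl⟩; exact hle s t hs ht)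
  exact abs_sub_le_iff.2 ⟨by linarith, by linarith⟩

section Sync

-- Instances on iterated spaces of continuous linear maps are not found at the default depth.
set_option maxSynthPendingDepth 3

variable {X : Type*} [NormedAddCommGroup X] [NormedSpace ℝ X]

/-- The solution `y`, run in the time `τ`, tracks `x` at the exponential rate `μ`, and `τ` is an
increasing reparameterization that approaches the shift `t ↦ t + θ` at the same rate. -/
structure PhaseTracks (μ C θ : ℝ) (τ : ℝ → ℝ) (x y : ℝ → X) : Prop where
  map_zero : τ 0 = 0
  strictMonoOn : StrictMonoOn τ (Ici 0)
  continuousOn : ContinuousOn τ (Ici 0)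
  norm_sub_le : ∀ t, 0 ≤ t → ‖x t - y (τ t)‖ ≤ C * Real.exp (-μ * t)
  phase_le : ∀ t, 0 ≤ t → |τ t - t - θ| ≤ C * Real.exp (-μ * t)

theorem exists_uniform_linearization {F : X → X} {K : Set X} (hF : ContDiff ℝ 1 F)
    (hK : IsCompact K) {ε : ℝ} (hε : 0 < ε) :
    ∃ η > 0, ∀ x ∈ K, ∀ y, ‖y - x‖ < η →
      ‖F y - F x - fderiv ℝ F x (y - x)‖ ≤ ε * ‖y - x‖ := by
  have hA : Continuous (fderiv ℝ F) := hF.continuous_fderiv one_ne_zero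
  have hu := hK.uniformContinuousAt_of_continuousAt (fderiv ℝ F) (fun x _ => hA.continuousAt)
    (Metric.dist_mem_uniformity hε)
  obtain ⟨η, hη, h⟩ := Metric.mem_uniformity_dist.1 hu
  refine ⟨η, hη, fun x hx y hy => ?_⟩
  refine (convex_ball x η).norm_image_sub_le_of_norm_fderiv_le'
    (fun z _ => hF.differentiable one_ne_zero z) (fun z hz => ?_) (Metric.mem_ball_self hη)
    (by rwa [Metric.mem_ball, dist_eq_norm])
  have h1 : dist x z < η := by rw [dist_comm]; exact hz
  have h2 : dist (fderiv ℝ F x) (fderiv ℝ F z) < ε := h h1 hx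
  rw [← dist_eq_norm, dist_comm]
  exact h2.le

variable {F : X → X} {K : Set X} {M : X → X →L[ℝ] X →L[ℝ] ℝ} {lam : ℝ}

/-- With the speed of `y` corrected by the feedback `1 - k · F(x)ᵀ M(x) (y - x)`, the squared
distance `(y - x)ᵀ M(x) (y - x)` of two nearby points of the region decreases exponentially: to
leading order the feedback contributes the penalty `-2 k (F(x)ᵀ M(x) (y - x))²`. -/
theorem TransverseContracting.exists_feedback [FiniteDimensional ℝ X]
    (h : TransverseContracting F K M lam) (hF : ContDiff ℝ 1 F) :
    ∃ k η, 0 ≤ k ∧ 0 < η ∧ ∀ x ∈ K, ∀ y ∈ K, ‖y - x‖ < η →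
      |k * M x (F x) (y - x)| ≤ 1 / 2 ∧
      fderivWithin ℝ M K x (F x) (y - x) (y - x) +
        2 * M x (y - x) ((1 - k * M x (F x) (y - x)) • F y - F x) ≤
          -(lam / 2) * M x (y - x) (y - x) := by
  obtain ⟨k, hk, hpen⟩ := h.exists_penalty hF
  obtain ⟨c, hc, hpos⟩ := h.metric.posDef
  have hlam := h.rate_pos
  obtain ⟨Cm', hCm⟩ := h.isCompact.exists_bound_of_continuousOn h.metric.contDiffOn.continuousOn
  obtain ⟨Cf', hCf⟩ := h.isCompact.exists_bound_of_continuousOn hF.continuous.continuousOn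
  obtain ⟨Ca', hCa⟩ := h.isCompact.exists_bound_of_continuousOn
    (hF.continuous_fderiv one_ne_zero).continuousOn
  set Cm := |Cm'| with hCm_def
  set Cf := |Cf'| with hCf_def
  set Ca := |Ca'| with hCa_def
  have hCm0 : 0 ≤ Cm := abs_nonneg _
  have hCf0 : 0 ≤ Cf := abs_nonneg _
  have hCa0 : 0 ≤ Ca := abs_nonneg _
  set ε : ℝ := min 1 (lam * c / 8 / (Cm + 1)) with hε_def
  have hε : 0 < ε := by positivity
  have hε1 : ε ≤ 1 := min_le_left _ _
  have hεC : ε * (Cm + 1) ≤ lam * c / 8 := by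
    rw [← le_div_iff₀ (by positivity)]; exact min_le_right _ _
  obtain ⟨η₁, hη₁, hlin⟩ := exists_uniform_linearization hF h.isCompact hε
  -- `ε` bounds the linearization error of `F`; `E` collects the constants of the cubic error term
  -- that comes from replacing `F y` by `F x` in the feedback.
  set E : ℝ := 2 * k * Cm ^ 2 * Cf * (Ca + 1) + 1 with hE_def
  have hE : 0 < E := by positivity
  have hG : 0 < k * Cm * Cf + 1 := by positivity
  refine ⟨k, min η₁ (min (lam * c / 4 / E) (1 / 2 / (k * Cm * Cf + 1))), hk, by positivity,
    fun x hx y hy hxy => ?_⟩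
  set e := y - x with he
  have hn1 : ‖e‖ < η₁ := hxy.trans_le (min_le_left _ _)
  have hn2 : ‖e‖ * E ≤ lam * c / 4 := by
    rw [← le_div_iff₀ hE]
    exact hxy.le.trans ((min_le_right _ _).trans (min_le_left _ _))
  have hn3 : ‖e‖ * (k * Cm * Cf + 1) ≤ 1 / 2 := by
    rw [← le_div_iff₀ hG]
    exact hxy.le.trans ((min_le_right _ _).trans (min_le_right _ _))
  have hMn : ‖M x‖ ≤ Cm := (hCm x hx).trans (le_abs_self _)
  have hFn : ‖F x‖ ≤ Cf := (hCf x hx).trans (le_abs_self _)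
  have hAn : ‖fderiv ℝ F x‖ ≤ Ca := (hCa x hx).trans (le_abs_self _)
  have hM2 : ∀ v w : X, |M x v w| ≤ Cm * ‖v‖ * ‖w‖ := fun v w =>
    ((M x).le_opNorm₂ v w).trans (by gcongr)
  set w := M x (F x) e with hw
  have hwn : |w| ≤ Cm * Cf * ‖e‖ := (hM2 _ _).trans (by gcongr)
  set R := F y - F x - fderiv ℝ F x e with hR
  have hRn : ‖R‖ ≤ ε * ‖e‖ := hlin x hx y hn1
  have hdF : F y - F x = fderiv ℝ F x e + R := by simp [hR]
  have hdFn : ‖F y - F x‖ ≤ (Ca + 1) * ‖e‖ := by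
    rw [hdF]
    refine (norm_add_le _ _).trans ?_
    have h1 := (fderiv ℝ F x).le_of_opNorm_le hAn e
    have h2 : ε * ‖e‖ ≤ 1 * ‖e‖ := by gcongr
    linarith
  have hsplit : (1 - k * w) • F y - F x =
      fderiv ℝ F x e + R - (k * w) • F x - (k * w) • (F y - F x) := by
    rw [← hdF]; module
  have hMR : M x e R ≤ Cm * ‖e‖ * (ε * ‖e‖) :=
    (le_abs_self _).trans ((hM2 _ _).trans (by gcongr))
  have hcross : -(w * M x e (F y - F x)) ≤ Cm * Cf * ‖e‖ * (Cm * ‖e‖ * ((Ca + 1) * ‖e‖)) := by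
    refine (neg_le_abs _).trans ?_
    rw [abs_mul]
    have := (hM2 e (F y - F x)).trans
      (by gcongr : Cm * ‖e‖ * ‖F y - F x‖ ≤ Cm * ‖e‖ * ((Ca + 1) * ‖e‖))
    gcongr
  have hsymm1 : M x e (F x) = w := h.metric.symm x hx _ _
  have hsymm2 : M x (fderiv ℝ F x e) e = M x e (fderiv ℝ F x e) := h.metric.symm x hx _ _
  have hQ := hpen x hx e
  refine ⟨?_, ?_⟩
  · rw [abs_mul, abs_of_nonneg hk]
    have := mul_le_mul_of_nonneg_left hwn hk
    linarith [norm_nonneg e]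
  · rw [hsplit]
    simp only [map_sub, map_add, map_smul, smul_eq_mul, metricRate, hsymm2] at hQ ⊢
    rw [hsymm1]
    rw [map_sub, hsymm1] at hcross
    have e1 := mul_le_mul_of_nonneg_left hcross (by positivity : (0 : ℝ) ≤ 2 * k)
    have e2 := mul_le_mul_of_nonneg_right hεC (sq_nonneg ‖e‖)
    have e3 := mul_le_mul_of_nonneg_right hn2 (sq_nonneg ‖e‖)
    have e4 := mul_le_mul_of_nonneg_left (hpos x hx e) (half_pos hlam).le
    have e5 : 0 ≤ ε * ‖e‖ ^ 2 := by positivity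
    have e6 : 0 ≤ ‖e‖ * ‖e‖ ^ 2 := by positivity
    have e7 : 0 ≤ k * w ^ 2 := by positivity
    rw [hE_def] at e3
    linarith [e1, e2, e3, e4, e5, e6, e7, hMR, hQ]

variable {x y : ℝ → X}

theorem IsForwardSolution.lipschitzOnWith (hx : IsForwardSolution F x) {C : NNReal}
    (hC : ∀ t, 0 ≤ t → ‖F (x t)‖ ≤ C) : LipschitzOnWith C x (Ici 0) :=
  (convex_Ici 0).lipschitzOnWith_of_nnnorm_hasDerivWithin_le hx fun t ht => hC t ht

/-- The reparameterizing equation `τ' = 1 - ψ(t, τ)` with the correction `ψ` truncated to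
`[-1/2, 1/2]`, so that its solution exists for all time and increases. -/
theorem exists_reparam {ψ : ℝ → ℝ → ℝ} {L : NNReal} (hψ : ∀ s, Continuous fun t => ψ t s)
    (hL : ∀ t, LipschitzWith L (ψ t)) :
    ∃ τ : ℝ → ℝ, τ 0 = 0 ∧ StrictMonoOn τ (Ici 0) ∧ ContinuousOn τ (Ici 0) ∧
      ∀ t, 0 ≤ t →
        HasDerivWithinAt τ (1 - max (-(1 / 2)) (min (1 / 2) (ψ t (τ t)))) (Ici 0) t := by
  set v : ℝ → ℝ → ℝ := fun t s => 1 - max (-(1 / 2)) (min (1 / 2) (ψ t s)) with hv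
  have hclamp : ∀ u : ℝ, |max (-(1 / 2)) (min (1 / 2) u)| ≤ 1 / 2 := fun u =>
    abs_le.2 ⟨le_max_left _ _, max_le (by norm_num) (min_le_left _ _)⟩
  obtain ⟨τ, h0, hτ⟩ := exists_isIntegralCurveOn_Ici_of_bounded_lipschitz (v := v) (L := L)
    (B := 2)
    (fun t => LipschitzWith.of_dist_le_mul fun s s' => by
      rw [hv, dist_sub_left]
      exact (((hL t).const_min _).const_max _).dist_le_mul s s')
    (fun s => continuous_const.sub (continuous_const.max (continuous_const.min (hψ s))))
    (fun t s => by
      refine (norm_sub_le _ _).trans ?_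
      have := hclamp (ψ t s)
      rw [← Real.norm_eq_abs] at this
      norm_num at this ⊢
      linarith) 0
  have hcont : ContinuousOn τ (Ici 0) := hτ.continuousOn
  refine ⟨τ, h0, ?_, hcont, fun t ht => hτ t ht⟩
  refine strictMonoOn_of_hasDerivWithinAt_pos (convex_Ici 0) hcont
    (fun t ht => (hτ t (interior_subset ht)).mono interior_subset) fun t _ => ?_
  have := (abs_le.1 (hclamp (ψ t (τ t)))).2
  simp only [hv]
  linarith

/-- Derivative of the squared distance, measured by `M` along `x`, of `x` and the time change
`y ∘ τ`. -/
theorem hasDerivWithinAt_metric_sub {τ : ℝ → ℝ} {s : ℝ} {t : ℝ} (hM : ContDiffOn ℝ 1 M K)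
    (hsymm : ∀ x ∈ K, ∀ u v : X, M x u v = M x v u)
    (hx : IsForwardSolution F x) (hy : IsForwardSolution F y) (hxK : ∀ t, 0 ≤ t → x t ∈ K)
    (hτ0 : ∀ t, 0 ≤ t → 0 ≤ τ t) (hτ : HasDerivWithinAt τ s (Ici 0) t) (ht : 0 ≤ t) :
    HasDerivWithinAt (fun t => M (x t) (y (τ t) - x t) (y (τ t) - x t))
      (fderivWithin ℝ M K (x t) (F (x t)) (y (τ t) - x t) (y (τ t) - x t) +
        2 * M (x t) (y (τ t) - x t) (s • F (y (τ t)) - F (x t))) (Ici 0) t := by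
  have hdM : HasFDerivWithinAt M (fderivWithin ℝ M K (x t)) K (x t) :=
    (hM.differentiableOn one_ne_zero (x t) (hxK t ht)).hasFDerivWithinAt
  have h1 : HasDerivWithinAt (fun t => M (x t)) (fderivWithin ℝ M K (x t) (F (x t))) (Ici 0) t :=
    hdM.comp_hasDerivWithinAt t (hx t ht) fun r hr => hxK r hr
  have h2 : HasDerivWithinAt (fun t => y (τ t)) (s • F (y (τ t))) (Ici 0) t :=
    (hy (τ t) (hτ0 t ht)).scomp t hτ fun r hr => hτ0 r hr
  have h3 : HasDerivWithinAt (fun t => y (τ t) - x t) (s • F (y (τ t)) - F (x t)) (Ici 0) t :=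
    h2.sub (hx t ht)
  refine ((h1.clm_apply h3).clm_apply h3).congr_deriv ?_
  simp only [add_apply]
  rw [hsymm (x t) (hxK t ht) (s • F (y (τ t)) - F (x t))]
  ring

/-- Nearby solutions synchronize: the distance after reparameterization, the phase error and the
limiting phase shift are all bounded by a multiple of the initial distance. -/
theorem TransverseContracting.exists_phaseTracks_of_near [FiniteDimensional ℝ X]
    (h : TransverseContracting F K M lam) (hF : ContDiff ℝ 1 F) :
    ∃ μ η D : ℝ, 0 < μ ∧ 0 < η ∧ 0 ≤ D ∧ ∀ x y : ℝ → X, IsForwardSolution F x →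
      IsForwardSolution F y → x 0 ∈ K → y 0 ∈ K → ‖y 0 - x 0‖ < η →
      ∃ τ θ, |θ| ≤ D * ‖y 0 - x 0‖ ∧ PhaseTracks μ (D * ‖y 0 - x 0‖) θ τ x y := by
  obtain ⟨k, η, hk, hη, hfeed⟩ := h.exists_feedback hF
  obtain ⟨c, hc, hpos⟩ := h.metric.posDef
  have hlam := h.rate_pos
  obtain ⟨Cm', hCm⟩ := h.isCompact.exists_bound_of_continuousOn h.metric.contDiffOn.continuousOn
  obtain ⟨Cf', hCf⟩ := h.isCompact.exists_bound_of_continuousOn hF.continuous.continuousOn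
  set Cm := |Cm'| + 1 with hCm_def
  set Cf := |Cf'| with hCf_def
  have hCm0 : 0 < Cm := by positivity
  have hCf0 : 0 ≤ Cf := abs_nonneg _
  have hMn : ∀ x ∈ K, ‖M x‖ ≤ Cm := fun x hx =>
    (hCm x hx).trans ((le_abs_self _).trans (by simp [hCm_def]))
  have hFn : ∀ x ∈ K, ‖F x‖ ≤ Cf := fun x hx => (hCf x hx).trans (le_abs_self _)
  -- `S` compares the norm with the metric, and `2 * μ = lam / 4` is a rate strictly below the rate
  -- `lam / 2` at which the feedback makes the squared distance decay.
  set S := √(Cm / c) with hS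
  have hS2 : S ^ 2 = Cm / c := Real.sq_sqrt (by positivity)
  have hS0 : 0 < S := Real.sqrt_pos.2 (by positivity)
  set μ := lam / 8 with hμ_def
  have hμ : 0 < μ := by positivity
  set D₁ := k * (Cm * Cf * S) with hD₁
  have hD₁0 : 0 ≤ D₁ := by positivity
  refine ⟨μ, η / S, S + D₁ / μ, hμ, by positivity, by positivity, ?_⟩
  intro x y hx hy hx0 hy0 hnear
  set n₀ := ‖y 0 - x 0‖ with hn₀
  have hn₀0 : 0 ≤ n₀ := norm_nonneg _
  have hxK : ∀ t, 0 ≤ t → x t ∈ K := fun t ht =>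
    hx.mem_of_mem h.invariant h.isCompact.isClosed hx0 ht
  have hyK : ∀ t, 0 ≤ t → y t ∈ K := fun t ht =>
    hy.mem_of_mem h.invariant h.isCompact.isClosed hy0 ht
  -- Solutions are only given on `[0, ∞)`, so they are frozen at negative times to obtain a
  -- feedback defined for all `t` and `s`.
  have hp : ∀ t : ℝ, 0 ≤ max t 0 := fun t => le_max_right _ _
  set ψ : ℝ → ℝ → ℝ := fun t s =>
    k * M (x (max t 0)) (F (x (max t 0))) (y (max s 0) - x (max t 0)) with hψ
  have hxc : Continuous fun t => x (max t 0) :=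
    hx.continuousOn.comp_continuous (by fun_prop) hp
  have hMc : Continuous fun t => M (x (max t 0)) :=
    h.metric.contDiffOn.continuousOn.comp_continuous hxc fun t => hxK _ (hp t)
  have hylip := hy.lipschitzOnWith (C := Cf.toNNReal) fun t ht =>
    (hFn _ (hyK t ht)).trans (Real.le_coe_toNNReal _)
  obtain ⟨τ, hτ0, hτmono, hτcont, hτ⟩ := exists_reparam (ψ := ψ)
    (L := (k * (Cm * Cf * Cf)).toNNReal)
    (fun s => continuous_const.mul ((hMc.clm_apply (hF.continuous.comp hxc)).clm_apply
      (continuous_const.sub hxc)))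
    (fun t => LipschitzWith.of_dist_le_mul fun s s' => by
      have h1 : ‖y (max s 0) - y (max s' 0)‖ ≤ Cf * |s - s'| := by
        have := hylip.dist_le_mul _ (hp s) _ (hp s')
        rw [dist_eq_norm, Real.coe_toNNReal _ hCf0] at this
        refine this.trans ?_
        have h2 := abs_max_sub_max_le_abs s s' 0
        rw [Real.dist_eq]
        exact mul_le_mul_of_nonneg_left h2 hCf0
      have h3 : ψ t s - ψ t s' =
          k * M (x (max t 0)) (F (x (max t 0))) (y (max s 0) - y (max s' 0)) := by
        simp only [hψ, map_sub]; ring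
      rw [Real.dist_eq, h3, abs_mul, abs_of_nonneg hk, Real.dist_eq,
        Real.coe_toNNReal _ (by positivity)]
      have h4 := ((M (x (max t 0))).le_opNorm₂ (F (x (max t 0))) (y (max s 0) - y (max s' 0))).trans
        (mul_le_mul (mul_le_mul (hMn _ (hxK _ (hp t))) (hFn _ (hxK _ (hp t))) (norm_nonneg _)
          hCm0.le) h1 (norm_nonneg _) (by positivity))
      have h5 := mul_le_mul_of_nonneg_left h4 hk
      rw [Real.norm_eq_abs] at h5
      linarith)
  have hτnn : ∀ t, 0 ≤ t → 0 ≤ τ t := fun t ht => by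
    have := hτmono.monotoneOn self_mem_Ici ht ht
    rwa [hτ0] at this
  set e : ℝ → X := fun t => y (τ t) - x t with he
  set V : ℝ → ℝ := fun t => M (x t) (e t) (e t) with hV
  have hψe : ∀ t, 0 ≤ t → ψ t (τ t) = k * M (x t) (F (x t)) (e t) := fun t ht => by
    simp only [hψ, max_eq_left ht, max_eq_left (hτnn t ht), he]
  have hclamp : ∀ t, 0 ≤ t → ‖e t‖ < η →
      max (-(1 / 2)) (min (1 / 2) (ψ t (τ t))) = k * M (x t) (F (x t)) (e t) := fun t ht hn => by
    have := abs_le.1 (hfeed _ (hxK t ht) _ (hyK _ (hτnn t ht)) hn).1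
    rw [hψe t ht, min_eq_right this.2, max_eq_right this.1]
  have hVd := fun t (ht : 0 ≤ t) => hasDerivWithinAt_metric_sub h.metric.contDiffOn
    h.metric.symm hx hy hxK hτnn (hτ t ht) ht
  have hVpos : ∀ t, 0 ≤ t → c * ‖e t‖ ^ 2 ≤ V t := fun t ht => hpos _ (hxK t ht) _
  have hV0 : V 0 ≤ Cm * n₀ ^ 2 := by
    have h1 : V 0 ≤ ‖M (x 0)‖ * ‖e 0‖ * ‖e 0‖ :=
      (le_abs_self _).trans ((M (x 0)).le_opNorm₂ (e 0) (e 0))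
    have h2 : ‖e 0‖ = n₀ := by simp [he, hτ0, hn₀]
    rw [h2] at h1
    have := mul_le_mul_of_nonneg_right (hMn _ hx0) (sq_nonneg n₀)
    linarith
  have hCη : Cm * n₀ ^ 2 < c * η ^ 2 := by
    have h1 : n₀ * S < η := by rwa [lt_div_iff₀ hS0] at hnear
    have h2 : (n₀ * S) ^ 2 < η ^ 2 := by gcongr
    rw [mul_pow, hS2] at h2
    have h3 := mul_lt_mul_of_pos_left h2 hc
    have h4 : c * (n₀ ^ 2 * (Cm / c)) = Cm * n₀ ^ 2 := by field_simp
    linarith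
  -- Fencing argument: the estimate on `V'` is available as long as `V < c η²`, in particular
  -- whenever `V` meets the decreasing barrier `b e^{-2μt}`.
  have hbarrier : ∀ b, Cm * n₀ ^ 2 < b → b < c * η ^ 2 → ∀ t, 0 ≤ t →
      V t ≤ b * Real.exp (-(2 * μ) * t) := by
    intro b hb hbη t ht
    have hb0 : 0 < b := lt_of_le_of_lt (by positivity) hb
    refine image_le_of_deriv_right_lt_deriv_boundary (f := V) (a := 0) (b := t)
      (B := fun t => b * Real.exp (-(2 * μ) * t))
      (B' := fun t => b * (Real.exp (-(2 * μ) * t) * (-(2 * μ))))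
      (fun r hr => ((hVd r hr.1).continuousWithinAt).mono Icc_subset_Ici_self)
      (fun r hr => (hVd r hr.1).mono (Ici_subset_Ici.2 hr.1)) (by simpa using hV0.trans hb.le)
      (fun r => by
        have := (((hasDerivAt_id r).const_mul (-(2 * μ))).exp).const_mul b
        simpa using this)
      (fun r hr hVr => ?_) (right_mem_Icc.2 ht)
    have hexp : Real.exp (-(2 * μ) * r) ≤ 1 := Real.exp_le_one_iff.2 (by nlinarith [hr.1])
    have hVr' : V r = b * Real.exp (-(2 * μ) * r) := hVr
    have hen : ‖e r‖ < η := by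
      have h1 : V r ≤ b := by rw [hVr']; nlinarith
      have h2 : ‖e r‖ ^ 2 < η ^ 2 := by
        have := hVpos r hr.1
        by_contra! h3
        have := mul_le_mul_of_nonneg_left h3 hc.le
        linarith
      exact lt_of_pow_lt_pow_left₀ 2 hη.le h2
    have h3 := (hfeed _ (hxK r hr.1) _ (hyK _ (hτnn r hr.1)) hen).2
    rw [hclamp r hr.1 hen]
    refine h3.trans_lt ?_
    have h4 : 0 < V r := by rw [hVr']; positivity
    have h5 : b * (Real.exp (-(2 * μ) * r) * (-(2 * μ))) = -(lam / 4) * V r := by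
      rw [hVr', hμ_def]; ring
    change -(lam / 2) * V r < b * (Real.exp (-(2 * μ) * r) * (-(2 * μ)))
    rw [h5]
    nlinarith
  have hVdecay : ∀ t, 0 ≤ t → V t ≤ Cm * n₀ ^ 2 * Real.exp (-(2 * μ) * t) := by
    intro t ht
    have hlim : Tendsto (fun b => b * Real.exp (-(2 * μ) * t)) (𝓝[>] (Cm * n₀ ^ 2))
        (𝓝 (Cm * n₀ ^ 2 * Real.exp (-(2 * μ) * t))) :=
      ((continuous_id.mul continuous_const).tendsto _).mono_left nhdsWithin_le_nhds
    refine ge_of_tendsto hlim ?_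
    filter_upwards [Ioo_mem_nhdsGT hCη] with b hb using hbarrier b hb.1 hb.2 t ht
  have hdecay : ∀ t, 0 ≤ t → ‖e t‖ ≤ S * n₀ * Real.exp (-μ * t) := by
    intro t ht
    refine le_of_sq_le_sq ?_ (by positivity)
    have h1 := (hVpos t ht).trans (hVdecay t ht)
    have h2 : Real.exp (-(2 * μ) * t) = Real.exp (-μ * t) ^ 2 := by
      rw [← Real.exp_nat_mul]; congr 1; push_cast; ring
    rw [h2, ← le_div_iff₀' hc] at h1
    refine h1.trans (le_of_eq ?_)
    rw [mul_pow, mul_pow, hS2]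
    ring
  have hen : ∀ t, 0 ≤ t → ‖e t‖ < η := by
    intro t ht
    refine (hdecay t ht).trans_lt ?_
    have h1 : Real.exp (-μ * t) ≤ 1 := Real.exp_le_one_iff.2 (by nlinarith)
    have h2 : n₀ * S < η := by rwa [lt_div_iff₀ hS0] at hnear
    have h3 : S * n₀ * Real.exp (-μ * t) ≤ S * n₀ * 1 := by gcongr
    linarith
  have hphase := exists_abs_sub_le_exp_of_deriv_le (σ := fun t => τ t - t) (D := D₁ * n₀) hμ
    (fun t ht => (hτ t ht).sub (hasDerivWithinAt_id t _)) fun t ht => by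
      rw [hclamp t ht (hen t ht), sub_sub_cancel_left, abs_neg, abs_mul, abs_of_nonneg hk]
      have h1 := ((M (x t)).le_opNorm₂ (F (x t)) (e t)).trans
        (mul_le_mul (mul_le_mul (hMn _ (hxK t ht)) (hFn _ (hxK t ht)) (norm_nonneg _)
          hCm0.le) (hdecay t ht) (norm_nonneg _) (by positivity))
      have h2 := mul_le_mul_of_nonneg_left h1 hk
      rw [Real.norm_eq_abs] at h2
      refine h2.trans (le_of_eq ?_)
      rw [hD₁]; ring
  obtain ⟨θ, hθ⟩ := hphase
  have hle : ∀ t : ℝ, D₁ * n₀ / μ * Real.exp (-μ * t) ≤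
      (S + D₁ / μ) * n₀ * Real.exp (-μ * t) := fun t => by
    have : 0 ≤ S * n₀ := by positivity
    have h1 : D₁ * n₀ / μ ≤ (S + D₁ / μ) * n₀ := by
      rw [add_mul, div_mul_eq_mul_div]; linarith
    gcongr
  refine ⟨τ, θ, ?_, hτ0, hτmono, hτcont, fun t ht => ?_, fun t ht => (hθ t ht).trans (hle t)⟩
  · have := (hθ 0 le_rfl).trans (hle 0)
    simpa [hτ0] using this
  · rw [norm_sub_rev]
    refine (hdecay t ht).trans ?_
    have : 0 ≤ D₁ / μ := by positivity
    gcongr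
    linarith

end Sync

/-! ### Synchronization of all solutions -/

section PhaseTracks

variable {X : Type*} [NormedAddCommGroup X] {x y z : ℝ → X}

theorem PhaseTracks.nonneg {μ C θ : ℝ} {τ : ℝ → ℝ} (h : PhaseTracks μ C θ τ x y) : 0 ≤ C := by
  have := (norm_nonneg _).trans (h.norm_sub_le 0 le_rfl)
  simpa using this

theorem PhaseTracks.mapsTo {μ C θ : ℝ} {τ : ℝ → ℝ} (h : PhaseTracks μ C θ τ x y) :
    MapsTo τ (Ici 0) (Ici 0) := fun t ht => by
  have := h.strictMonoOn.monotoneOn self_mem_Ici ht ht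
  rwa [h.map_zero] at this

theorem PhaseTracks.le_apply {μ C θ : ℝ} {τ : ℝ → ℝ} (h : PhaseTracks μ C θ τ x y) (hμ : 0 < μ)
    {t : ℝ} (ht : 0 ≤ t) : t + (θ - C) ≤ τ t := by
  have h1 := (abs_le.1 (h.phase_le t ht)).1
  have h2 : Real.exp (-μ * t) ≤ 1 := Real.exp_le_one_iff.2 (by nlinarith)
  have h3 := mul_le_mul_of_nonneg_left h2 h.nonneg
  linarith

theorem PhaseTracks.tendsto_atTop {μ C θ : ℝ} {τ : ℝ → ℝ} (h : PhaseTracks μ C θ τ x y)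
    (hμ : 0 < μ) : Tendsto τ atTop atTop :=
  tendsto_atTop_mono' atTop ((eventually_ge_atTop 0).mono fun _ ht => h.le_apply hμ ht)
    (tendsto_atTop_add_const_right _ _ tendsto_id)

/-- Tracking composes without loss of the rate, since `τ t - t` stays bounded. -/
theorem PhaseTracks.trans {μ C C' θ θ' : ℝ} {τ τ' : ℝ → ℝ} (hμ : 0 < μ)
    (h : PhaseTracks μ C θ τ x y) (h' : PhaseTracks μ C' θ' τ' y z) :
    PhaseTracks μ (C + C' * Real.exp (μ * (C - θ))) (θ + θ') (fun t => τ' (τ t)) x z := by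
  have hexp : ∀ t, 0 ≤ t →
      C' * Real.exp (-μ * τ t) ≤ C' * Real.exp (μ * (C - θ)) * Real.exp (-μ * t) := fun t ht => by
    rw [mul_assoc, ← Real.exp_add]
    refine mul_le_mul_of_nonneg_left (Real.exp_le_exp.2 ?_) h'.nonneg
    have := mul_le_mul_of_nonneg_left (h.le_apply hμ ht) hμ.le
    linarith
  refine ⟨by rw [h.map_zero, h'.map_zero], h'.strictMonoOn.comp h.strictMonoOn h.mapsTo,
    h'.continuousOn.comp h.continuousOn h.mapsTo, fun t ht => ?_, fun t ht => ?_⟩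
  · have h1 := h.norm_sub_le t ht
    have h2 := h'.norm_sub_le (τ t) (h.mapsTo ht)
    have h3 := norm_sub_le_norm_sub_add_norm_sub (x t) (y (τ t)) (z (τ' (τ t)))
    linarith [hexp t ht]
  · have h1 := h.phase_le t ht
    have h2 := h'.phase_le (τ t) (h.mapsTo ht)
    have h3 : τ' (τ t) - t - (θ + θ') = (τ' (τ t) - τ t - θ') + (τ t - t - θ) := by ring
    rw [h3]
    refine (abs_add_le _ _).trans ?_
    linarith [hexp t ht]

/-- If a solution is synchronized with a periodic one it converges to the periodic orbit. -/
theorem PhaseTracks.tendsto_infDist {μ C θ : ℝ} {τ : ℝ → ℝ} (hμ : 0 < μ)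
    (h : PhaseTracks μ C θ τ x y) :
    Tendsto (fun t => Metric.infDist (x t) (range y)) atTop (𝓝 0) := by
  have hexp : Tendsto (fun t => C * Real.exp (-μ * t)) atTop (𝓝 0) := by
    have h1 : Tendsto (fun t : ℝ => -μ * t) atTop atBot :=
      tendsto_id.const_mul_atTop_of_neg (neg_neg_of_pos hμ)
    simpa using (Real.tendsto_exp_atBot.comp h1).const_mul C
  refine squeeze_zero' (Eventually.of_forall fun _ => Metric.infDist_nonneg) ?_ hexp
  filter_upwards [eventually_ge_atTop 0] with t ht
  have := h.norm_sub_le t ht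
  rw [← dist_eq_norm] at this
  exact (Metric.infDist_le_dist_of_mem (mem_range_self _)).trans this

end PhaseTracks

section Chain

variable {X : Type*} [NormedAddCommGroup X] [NormedSpace ℝ X]
variable {F : X → X} {K : Set X} {M : X → X →L[ℝ] X →L[ℝ] ℝ} {lam : ℝ}

/-- In a connected region any two points are joined by a chain of arbitrarily small steps, so the
synchronization of nearby solutions propagates to all pairs of solutions. -/
theorem TransverseContracting.exists_phaseTracks [FiniteDimensional ℝ X]
    (h : TransverseContracting F K M lam) (hF : ContDiff ℝ 1 F) (hK : IsPreconnected K) :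
    ∃ μ > 0, ∀ x y : ℝ → X, IsForwardSolution F x → IsForwardSolution F y → x 0 ∈ K → y 0 ∈ K →
      ∃ C θ τ, PhaseTracks μ C θ τ x y := by
  obtain ⟨μ, η, D, hμ, hη, -, hnear⟩ := h.exists_phaseTracks_of_near hF
  refine ⟨μ, hμ, fun x y hx hy hx0 hy0 => ?_⟩
  refine hK.induction₂' (fun a b => ∀ x y : ℝ → X, IsForwardSolution F x → IsForwardSolution F y →
    x 0 = a → y 0 = b → ∃ C θ τ, PhaseTracks μ C θ τ x y) (fun a ha => ?_) ?_ hx0 hy0 x y hx hy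
    rfl rfl
  · filter_upwards [mem_nhdsWithin_of_mem_nhds (Metric.ball_mem_nhds a hη), self_mem_nhdsWithin]
      with b hb hbK
    rw [Metric.mem_ball, dist_eq_norm] at hb
    constructor
    · rintro x y hx hy rfl rfl
      obtain ⟨τ, θ, -, hτ⟩ := hnear x y hx hy ha hbK hb
      exact ⟨_, θ, τ, hτ⟩
    · rintro x y hx hy rfl rfl
      obtain ⟨τ, θ, -, hτ⟩ := hnear x y hx hy hbK ha (by rwa [norm_sub_rev])
      exact ⟨_, θ, τ, hτ⟩
  · rintro a b c - hb - hab hbc x z hx hz hxa hzc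
    obtain ⟨y, hy, hyb⟩ := h.invariant.exists_isForwardSolution h.isCompact hF hb
    obtain ⟨C, θ, τ, hτ⟩ := hab x y hx hy hxa hyb
    obtain ⟨C', θ', τ', hτ'⟩ := hbc y z hy hz hyb hzc
    exact ⟨_, _, _, hτ.trans hμ hτ'⟩

theorem TransverseContracting.convergeUpToReparam [FiniteDimensional ℝ X]
    (h : TransverseContracting F K M lam) (hF : ContDiff ℝ 1 F) (hK : IsPreconnected K) :
    ConvergeUpToReparam F K := by
  obtain ⟨μ, hμ, hsync⟩ := h.exists_phaseTracks hF hK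
  refine ⟨μ, hμ, fun x y hx hy hx0 hy0 => ?_⟩
  obtain ⟨C, θ, τ, hτ⟩ := hsync x y hx hy hx0 hy0
  exact ⟨C, τ, hτ.map_zero, hτ.strictMonoOn, hτ.continuousOn, hτ.tendsto_atTop hμ,
    hτ.norm_sub_le⟩

end Chain

/-! ### The limit cycle -/

section LimitCycle

variable {X : Type*} [NormedAddCommGroup X] [NormedSpace ℝ X]
variable {F : X → X} {K : Set X} {M : X → X →L[ℝ] X →L[ℝ] ℝ} {lam : ℝ} {x : ℝ → X}

theorem exists_lipschitzOnWith_of_contDiff_one [FiniteDimensional ℝ X] (hF : ContDiff ℝ 1 F)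
    (hK : IsCompact K) : ∃ L, LipschitzOnWith L F K := by
  obtain ⟨R, hR⟩ := hK.isBounded.subset_closedBall (0 : X)
  obtain ⟨C, hC⟩ := (isCompact_closedBall (0 : X) R).exists_bound_of_continuousOn
    (hF.continuous_fderiv one_ne_zero).continuousOn
  exact ⟨C.toNNReal, ((convex_closedBall 0 R).lipschitzOnWith_of_nnnorm_fderiv_le
    (fun x _ => hF.differentiable one_ne_zero x)
    fun x hx => (hC x hx).trans (Real.le_coe_toNNReal C)).mono hR⟩

/-- A solution returns arbitrarily close to an earlier position, and the two resulting solutions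
synchronize with a small phase shift. So some solution is exponentially close to its own translate
by a positive time. -/
theorem TransverseContracting.exists_asymptotically_periodic [FiniteDimensional ℝ X]
    (h : TransverseContracting F K M lam) (hF : ContDiff ℝ 1 F) (hne : K.Nonempty) :
    ∃ (z : ℝ → X) (T μ C : ℝ), 0 < T ∧ 0 < μ ∧ IsForwardSolution F z ∧ z 0 ∈ K ∧
      ∀ u, 0 ≤ u → ‖z u - z (u + T)‖ ≤ C * Real.exp (-μ * u) := by
  obtain ⟨μ, η, D, hμ, hη, hD, hnear⟩ := h.exists_phaseTracks_of_near hF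
  obtain ⟨B', hB⟩ := h.isCompact.exists_bound_of_continuousOn hF.continuous.continuousOn
  obtain ⟨p, hp⟩ := hne
  obtain ⟨x, hx, rfl⟩ := h.invariant.exists_isForwardSolution h.isCompact hF hp
  have hxK : ∀ t, 0 ≤ t → x t ∈ K := fun t ht =>
    hx.mem_of_mem h.invariant h.isCompact.isClosed hp ht
  have hlip := hx.lipschitzOnWith (C := B'.toNNReal) fun t ht =>
    (hB _ (hxK t ht)).trans (Real.le_coe_toNNReal _)
  obtain ⟨a, -, φ, hφ, hlim⟩ := h.isCompact.tendsto_subseq (x := fun n : ℕ => x n)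
    fun n => hxK n n.cast_nonneg
  obtain ⟨N, hN⟩ := Metric.cauchySeq_iff'.1 hlim.cauchySeq (min η (1 / (D + 1))) (by positivity)
  have hclose := hN (N + 1) (Nat.le_succ N)
  set i := φ N with hi
  set j := φ (N + 1) with hj
  have hij : (i : ℝ) + 1 ≤ j := by
    have : i < j := hφ (Nat.lt_succ_self N)
    exact_mod_cast this
  have hi0 : (0 : ℝ) ≤ i := i.cast_nonneg
  have hdist : ‖x j - x i‖ < min η (1 / (D + 1)) := by rwa [← dist_eq_norm]
  obtain ⟨τ, θ, hθ, hτ⟩ := hnear (fun t => x (t + i)) (fun t => x (t + j)) (hx.comp_add hi0)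
    (hx.comp_add (by linarith)) (by simpa using hxK i hi0) (by simpa using hxK j (by linarith))
    (by simpa using hdist.trans_le (min_le_left _ _))
  simp only [zero_add] at hθ hτ
  have hθ1 : |θ| < 1 := by
    have h1 : ‖x j - x i‖ * (D + 1) < 1 := by
      rw [← lt_div_iff₀ (by positivity)]; exact hdist.trans_le (min_le_right _ _)
    linarith [norm_nonneg (x j - x i)]
  have hθ2 := (abs_lt.1 hθ1).1
  refine ⟨fun t => x (t + i), j - i + θ, μ, D * ‖x j - x i‖ + B'.toNNReal * (D * ‖x j - x i‖),
    by linarith, hμ, hx.comp_add hi0, by simpa using hxK i hi0, fun u hu => ?_⟩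
  have h1 := hτ.norm_sub_le u hu
  have h2 := hlip.dist_le_mul (τ u + j) (by have := hτ.mapsTo hu; simp only [mem_Ici] at *; linarith)
    (u + (j - i + θ) + i) (by simp only [mem_Ici]; linarith)
  rw [dist_eq_norm, Real.dist_eq] at h2
  have h3 := hτ.phase_le u hu
  have h4 : τ u + j - (u + (j - i + θ) + i) = τ u - u - θ := by ring
  rw [h4] at h2
  have h5 := mul_le_mul_of_nonneg_left h3 B'.toNNReal.coe_nonneg
  have h6 := norm_sub_le_norm_sub_add_norm_sub (x (u + i)) (x (τ u + j)) (x (u + (j - i + θ) + i))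
  linarith

/-- The translates by multiples of the asymptotic period converge to a periodic solution. -/
theorem TransverseContracting.exists_periodic_forwardSolution [FiniteDimensional ℝ X]
    (h : TransverseContracting F K M lam) (hF : ContDiff ℝ 1 F) (hne : K.Nonempty) :
    ∃ (x : ℝ → X) (T : ℝ), 0 < T ∧ IsForwardSolution F x ∧ x 0 ∈ K ∧
      ∀ u, 0 ≤ u → x (u + T) = x u := by
  have : CompleteSpace X := FiniteDimensional.complete ℝ X
  obtain ⟨z, T, μ, C, hT, hμ, hz, hz0, hzT⟩ := h.exists_asymptotically_periodic hF hne
  have hcl := h.isCompact.isClosed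
  have hzK : ∀ t, 0 ≤ t → z t ∈ K := fun t ht => hz.mem_of_mem h.invariant hcl hz0 ht
  have hnT : ∀ n : ℕ, 0 ≤ n * T := fun n => by positivity
  have hcauchy : CauchySeq fun n : ℕ => z (n * T) := by
    refine cauchySeq_of_le_geometric (Real.exp (-μ * T)) C
      (Real.exp_lt_one_iff.2 (by nlinarith)) fun n => ?_
    have h1 := hzT (n * T) (hnT n)
    have h2 : ((n + 1 : ℕ) : ℝ) * T = n * T + T := by push_cast; ring
    have h3 : (n : ℝ) * (-μ * T) = -μ * (n * T) := by ring
    rwa [dist_eq_norm, ← Real.exp_nat_mul, h2, h3]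
  obtain ⟨p, hp⟩ := cauchySeq_tendsto_of_complete hcauchy
  have hpK : p ∈ K := hcl.mem_of_tendsto hp (Eventually.of_forall fun n => hzK _ (hnT n))
  obtain ⟨x, hx, rfl⟩ := h.invariant.exists_isForwardSolution h.isCompact hF hpK
  obtain ⟨L, hL⟩ := exists_lipschitzOnWith_of_contDiff_one hF h.isCompact
  have hxK : ∀ t, 0 ≤ t → x t ∈ K := fun t ht => hx.mem_of_mem h.invariant hcl hpK ht
  have hconv : ∀ u, 0 ≤ u → Tendsto (fun n : ℕ => z (u + n * T)) atTop (𝓝 (x u)) := by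
    intro u hu
    rw [tendsto_iff_dist_tendsto_zero] at hp ⊢
    have hb : Tendsto (fun n : ℕ => dist (z (n * T)) (x 0) * Real.exp (L * (u - 0))) atTop
        (𝓝 0) := by simpa using hp.mul_const (Real.exp (L * (u - 0)))
    refine squeeze_zero (fun _ => dist_nonneg) (fun n => ?_) hb
    have hzn := hz.comp_add (hnT n)
    exact dist_le_of_trajectories_ODE_of_mem (v := fun _ => F) (s := fun _ => K)
      (fun _ _ => hL) (hzn.continuousOn.mono Icc_subset_Ici_self)
      (fun t ht => hzn.hasDerivWithinAt_Ici ht.1)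
      (fun t ht => hzK _ (add_nonneg ht.1 (hnT n))) (hx.continuousOn.mono Icc_subset_Ici_self)
      (fun t ht => hx.hasDerivWithinAt_Ici ht.1) (fun t ht => hxK t ht.1) (by simp) u
      (right_mem_Icc.2 hu)
  refine ⟨x, T, hT, hx, hpK, fun u hu => ?_⟩
  refine tendsto_nhds_unique (hconv (u + T) (by positivity)) ?_
  have := (hconv u hu).comp (tendsto_add_atTop_nat 1)
  refine this.congr fun n => ?_
  simp only [Function.comp_apply]
  push_cast
  ring_nf

/-- A forward solution that is periodic on `[0, ∞)` extends to a periodic solution on `ℝ`. -/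
theorem IsForwardSolution.exists_periodic_extension (hx : IsForwardSolution F x) {T : ℝ}
    (hT : 0 < T) (hper : ∀ u, 0 ≤ u → x (u + T) = x u) :
    ∃ γ : ℝ → X, IsIntegralCurve γ (fun _ => F) ∧ Function.Periodic γ T ∧
      (∀ u, 0 ≤ u → γ u = x u) ∧ ∀ u, ∃ s > 0, γ u = x s := by
  have hnat : ∀ (n : ℕ) (u : ℝ), 0 ≤ u → x (u + n * T) = x u := by
    intro n u hu
    induction n with
    | zero => simp
    | succ n ih =>
      have := hper (u + n * T) (by positivity)
      rw [← ih, ← this]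
      push_cast
      ring_nf
  set γ : ℝ → X := fun u => x (u + ⌈|u| / T⌉₊ * T) with hγ
  have hnn : ∀ u : ℝ, 0 ≤ u + ⌈|u| / T⌉₊ * T := fun u => by
    have h1 := (div_le_iff₀ hT).1 (Nat.le_ceil (|u| / T))
    linarith [neg_abs_le u]
  have hγeq : ∀ (u : ℝ) (n : ℕ), 0 ≤ u + n * T → γ u = x (u + n * T) := by
    intro u n hn
    simp only [hγ]
    rw [← hnat n _ (hnn u), ← hnat ⌈|u| / T⌉₊ _ hn]
    ring_nf
  have hpos : ∀ u : ℝ, 0 < u + ((⌈|u| / T⌉₊ + 1 : ℕ) : ℝ) * T := fun u => by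
    push_cast
    linarith [hnn u]
  refine ⟨γ, fun u => ?_, fun u => ?_, fun u hu => ?_, fun u => ⟨_, hpos u, hγeq u _ (hpos u).le⟩⟩
  · set n := ⌈|u| / T⌉₊ + 1 with hn
    have h1 : HasDerivAt (fun v => x (v + n * T)) (F (x (u + n * T))) u :=
      (hx.hasDerivAt (hpos u)).comp_add_const u (n * T)
    have h2 : γ =ᶠ[𝓝 u] fun v => x (v + n * T) := by
      filter_upwards [Ioi_mem_nhds (show -(n * T) < u by linarith [hpos u])] with v hv
      exact hγeq v n (by linarith [mem_Ioi.1 hv])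
    have h3 := h1.congr_of_eventuallyEq h2
    rwa [← hγeq u n (hpos u).le] at h3
  · have h1 := hper _ (hnn u)
    rw [hγeq (u + T) ⌈|u| / T⌉₊ (by linarith [hnn u]), hγ]
    dsimp only
    rw [← h1]
    ring_nf
  · simpa using hγeq u 0 (by simpa using hu)

theorem Function.Periodic.exists_least_period {Y : Type*} [TopologicalSpace Y] [T2Space Y]
    {γ : ℝ → Y} (hγ : Continuous γ) {T : ℝ} (hT : 0 < T) (hper : Function.Periodic γ T)
    (hconst : ¬ ∀ t, γ t = γ 0) :
    ∃ T₀, 0 < T₀ ∧ Function.Periodic γ T₀ ∧ ∀ S, 0 < S → S < T₀ → ¬ Function.Periodic γ S := by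
  let P : AddSubgroup ℝ :=
    { carrier := {c | Function.Periodic γ c}
      add_mem' := fun ha hb => ha.add_period hb
      zero_mem' := fun t => by simp
      neg_mem' := fun ha => ha.neg }
  have hleast : ∃ a, IsLeast {g : ℝ | g ∈ P ∧ 0 < g} a := by
    by_contra hno
    have hbot : P ≠ ⊥ := fun hb => by
      have : T ∈ P := hper
      rw [hb, AddSubgroup.mem_bot] at this
      exact hT.ne' this
    have hdense := P.dense_of_no_min hbot hno
    refine hconst fun t => congrFun (hγ.ext_on hdense continuous_const fun c hc => ?_) t
    have : Function.Periodic γ c := hc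
    simpa using this 0
  obtain ⟨a, ⟨haP, ha0⟩, hmin⟩ := hleast
  exact ⟨a, ha0, haP, fun S hS hSa hSP => hSa.not_ge (hmin ⟨hSP, hS⟩)⟩

/-- A connected transverse contracting region without equilibria contains exactly one periodic
orbit, and it attracts the region. -/
theorem TransverseContracting.exists_unique_limitCycle [FiniteDimensional ℝ X]
    (h : TransverseContracting F K M lam) (hF : ContDiff ℝ 1 F) (hK : IsConnected K)
    (hne : ∀ x ∈ K, F x ≠ 0) :
    ∃ (O : Set X) (T : ℝ), 0 < T ∧ IsPeriodicOrbit F O T ∧ O ⊆ interior K ∧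
      (∀ (O' : Set X) (T' : ℝ), IsPeriodicOrbit F O' T' → O' ⊆ K → O' = O) ∧
      ∀ x : ℝ → X, IsForwardSolution F x → x 0 ∈ K →
        Tendsto (fun t => Metric.infDist (x t) O) atTop (𝓝 0) := by
  obtain ⟨μ, hμ, hsync⟩ := h.exists_phaseTracks hF hK.isPreconnected
  obtain ⟨x, T, hT, hx, hx0, hper⟩ := h.exists_periodic_forwardSolution hF hK.nonempty
  obtain ⟨γ, hγ, hγT, hγx, hγpos⟩ := hx.exists_periodic_extension hT hper
  have hcl := h.isCompact.isClosed
  have hint : range γ ⊆ interior K := by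
    rintro _ ⟨u, rfl⟩
    obtain ⟨s, hs, hus⟩ := hγpos u
    rw [hus]
    exact hx.mem_interior_of_pos h.invariant hcl hx0 hs
  have hγK : ∀ t, γ t ∈ K := fun t => interior_subset (hint (mem_range_self t))
  have hconst : ¬ ∀ t, γ t = γ 0 := fun hc => by
    have h1 : HasDerivAt γ 0 0 := by
      rw [funext hc]; exact hasDerivAt_const _ _
    exact hne _ (hγK 0) ((hγ 0).unique h1)
  obtain ⟨T₀, hT₀, hγT₀, hleast⟩ := hγT.exists_least_period hγ.continuous hT hconst
  have hattr : ∀ y : ℝ → X, IsForwardSolution F y → y 0 ∈ K →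
      Tendsto (fun t => Metric.infDist (y t) (range γ)) atTop (𝓝 0) := fun y hy hy0 => by
    obtain ⟨C, θ, τ, hτ⟩ := hsync y γ hy (hγ.isIntegralCurveOn _) hy0 (hγK 0)
    exact hτ.tendsto_infDist hμ
  refine ⟨range γ, T₀, hT₀, ⟨hT₀, γ, hγ, hγT₀, hleast, rfl⟩, hint, ?_, hattr⟩
  rintro _ T' ⟨hT', γ', hγ', hγT', -, rfl⟩ hsub
  have hγK' : ∀ t, γ' t ∈ K := fun t => hsub (mem_range_self t)
  -- Along the periodic `γ'` the distance to the attracting orbit both tends to `0` and recurs.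
  have hzero : Metric.infDist (γ' 0) (range γ) = 0 := by
    have h1 : Tendsto (fun n : ℕ => (n : ℝ) * T') atTop atTop :=
      tendsto_natCast_atTop_atTop.atTop_mul_const hT'
    have h2 := (hattr γ' (hγ'.isIntegralCurveOn _) (hγK' 0)).comp h1
    refine tendsto_nhds_unique (Tendsto.congr (fun n => ?_) tendsto_const_nhds) h2
    simp only [Function.comp_apply]
    rw [← hγT'.nat_mul n 0, zero_add]
  have hclosed : IsClosed (range γ) :=
    (hγT₀.compact_of_continuous hT₀.ne' hγ.continuous).isClosed
  obtain ⟨s, hs⟩ := (hclosed.mem_iff_infDist_zero (range_nonempty γ)).2 hzero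
  obtain ⟨L, hL⟩ := exists_lipschitzOnWith_of_contDiff_one hF h.isCompact
  have heq : γ' = fun t => γ (t + s) :=
    ODE_solution_unique_univ (v := fun _ => F) (s := fun _ => K) (t₀ := 0) (fun _ => hL)
      (fun t => ⟨hγ' t, hγK' t⟩) (fun t => ⟨hγ.comp_add s t, hγK _⟩) (by simp [hs])
  rw [heq]
  exact (Equiv.addRight s).surjective.range_comp γ

end LimitCycle

/-! ### The coupled oscillators -/

section Network

variable {N n m : ℕ} {Ω : Type*}
  {f : EuclideanSpace ℝ (Fin n) → EuclideanSpace ℝ (Fin m) → Ω → EuclideanSpace ℝ (Fin n)}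
  {r : EuclideanSpace ℝ (Fin m)}

theorem coupledField_contDiff (nbr : Fin N → Finset (Fin N))
    (G : Fin N → Fin N → Matrix (Fin n) (Fin n) ℝ) {ω : Fin N → Ω}
    (hf : ∀ i, ContDiff ℝ 1 fun x => f x r (ω i)) : ContDiff ℝ 1 (coupledField f nbr G r ω) := by
  have hproj : ∀ i, ContDiff ℝ 1 fun x : NetworkState N n => x i := fun i =>
    (PiLp.proj 2 (fun _ : Fin N => EuclideanSpace ℝ (Fin n)) i : _ →L[ℝ] _).contDiff
  refine contDiff_piLp' 2 fun i => ?_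
  refine ((hf i).comp (hproj i)).add (ContDiff.sum fun j _ => ?_)
  exact (Matrix.toEuclideanCLM (𝕜 := ℝ) (G i j)).contDiff.comp ((hproj j).sub (hproj i))

theorem norm_fderiv_comp_pi_le {ι X Y Z V : Type*} [Fintype ι] [NormedAddCommGroup X]
    [NormedSpace ℝ X] [NormedAddCommGroup Y] [NormedSpace ℝ Y] [NormedAddCommGroup Z]
    [NormedSpace ℝ Z] [NormedAddCommGroup V] [NormedSpace ℝ V] (E : (ι → Z) →L[ℝ] V)
    {g : ι → Y → Z} {p : ι → X →L[ℝ] Y} {x : X} {ε : ℝ} (hε : 0 ≤ ε)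
    (hg : ∀ i, DifferentiableAt ℝ (g i) (p i x)) (hD : ∀ i, ‖fderiv ℝ (g i) (p i x)‖ ≤ ε)
    (hp : ∀ i z, ‖p i z‖ ≤ ‖z‖) :
    ‖fderiv ℝ (fun z => E fun i => g i (p i z)) x‖ ≤ ‖E‖ * ε := by
  have hder : HasFDerivAt (fun z => E fun i => g i (p i z))
      (E.comp (ContinuousLinearMap.pi fun i => (fderiv ℝ (g i) (p i x)).comp (p i))) x :=
    E.hasFDerivAt.comp x
      (hasFDerivAt_pi.2 fun i => (hg i).hasFDerivAt.comp x (p i).hasFDerivAt)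
  rw [hder.fderiv]
  refine ContinuousLinearMap.opNorm_le_bound _ (by positivity) fun δ => ?_
  rw [mul_assoc]
  refine E.le_of_opNorm_le_of_le le_rfl ((pi_norm_le_iff_of_nonneg (by positivity)).2 fun i => ?_)
  exact (fderiv ℝ (g i) (p i x)).le_of_opNorm_le_of_le (hD i) (hp i δ)

/-- The coupling terms cancel in the difference of two networks, so the distance of the networks in
`C¹` is controlled by that of the individual oscillators. -/
theorem exists_norm_coupledField_sub_le (N n : ℕ) :
    ∃ C : ℝ, 0 ≤ C ∧ ∀ {m : ℕ} {Ω : Type*}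
      (f : EuclideanSpace ℝ (Fin n) → EuclideanSpace ℝ (Fin m) → Ω → EuclideanSpace ℝ (Fin n))
      (r : EuclideanSpace ℝ (Fin m)) (nbr : Fin N → Finset (Fin N))
      (G : Fin N → Fin N → Matrix (Fin n) (Fin n) ℝ) (ω ω' : Fin N → Ω),
      (∀ i, ContDiff ℝ 1 fun x => f x r (ω i)) → (∀ i, ContDiff ℝ 1 fun x => f x r (ω' i)) →
      ∀ (x : NetworkState N n) (ε : ℝ), 0 ≤ ε →
        ((∀ i, ‖f (x i) r (ω i) - f (x i) r (ω' i)‖ ≤ ε) →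
          ‖coupledField f nbr G r ω x - coupledField f nbr G r ω' x‖ ≤ C * ε) ∧
        ((∀ i, ‖fderiv ℝ (fun x => f x r (ω i)) (x i) -
            fderiv ℝ (fun x => f x r (ω' i)) (x i)‖ ≤ ε) →
          ‖fderiv ℝ (coupledField f nbr G r ω) x - fderiv ℝ (coupledField f nbr G r ω') x‖
            ≤ C * ε) := by
  set E : (Fin N → EuclideanSpace ℝ (Fin n)) →L[ℝ] NetworkState N n :=
    (PiLp.continuousLinearEquiv 2 ℝ
      fun _ : Fin N => EuclideanSpace ℝ (Fin n)).symm.toContinuousLinearMap with hE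
  refine ⟨‖E‖, norm_nonneg _, fun {m Ω} f r nbr G ω ω' hω hω' x ε hε => ?_⟩
  have hdiff : ∀ z, coupledField f nbr G r ω z - coupledField f nbr G r ω' z =
      E fun i => f (z i) r (ω i) - f (z i) r (ω' i) := fun z => by
    ext i : 1
    simp [coupledField, hE]
  refine ⟨fun h => ?_, fun h => ?_⟩
  · rw [hdiff]
    exact E.le_of_opNorm_le_of_le le_rfl ((pi_norm_le_iff_of_nonneg hε).2 h)
  · rw [← fderiv_sub ((coupledField_contDiff nbr G hω).differentiable one_ne_zero x)
      ((coupledField_contDiff nbr G hω').differentiable one_ne_zero x)]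
    have heq : coupledField f nbr G r ω - coupledField f nbr G r ω' =
        fun z => E fun i => (f (z i) r (ω i) - f (z i) r (ω' i)) := funext hdiff
    rw [heq]
    have hd : ∀ i z, DifferentiableAt ℝ (fun x => f x r (ω i)) z := fun i =>
      (hω i).differentiable one_ne_zero
    have hd' : ∀ i z, DifferentiableAt ℝ (fun x => f x r (ω' i)) z := fun i =>
      (hω' i).differentiable one_ne_zero
    exact norm_fderiv_comp_pi_le E (g := fun i u => f u r (ω i) - f u r (ω' i))
      (p := fun i => PiLp.proj 2 (fun _ : Fin N => EuclideanSpace ℝ (Fin n)) i) hε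
      (fun i => (hd i _).sub (hd' i _))
      (fun i => by rw [fderiv_fun_sub (hd i _) (hd' i _)]; exact h i)
      fun i δ => PiLp.norm_apply_le δ i

end Network

/-- For parameters near an interior point of the continuity region, a family of `C¹` maps is
uniformly `C¹`-close to its value at that point on each compact set. -/
theorem eventually_forall_norm_sub_lt {Y Z Ω : Type*} [NormedAddCommGroup Y] [NormedAddCommGroup Z]
    [TopologicalSpace Ω] {P : Set Ω} {g : Y → Ω → Z}
    (hg : ContinuousOn (fun q : Y × Ω => g q.1 q.2) (univ ×ˢ P)) {ω₀ : Ω} (hω₀ : ω₀ ∈ interior P)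
    {S : Set Y} (hS : IsCompact S) {ε : ℝ} (hε : 0 < ε) :
    ∀ᶠ ω in 𝓝 ω₀, ∀ x ∈ S, ‖g x ω - g x ω₀‖ < ε := by
  refine hS.eventually_forall_of_forall_eventually fun x _ => ?_
  have hP : P ∈ 𝓝 ω₀ := mem_interior_iff_mem_nhds.1 hω₀
  have hat : ContinuousAt (fun q : Y × Ω => g q.1 q.2) (x, ω₀) :=
    hg.continuousAt (prod_mem_nhds univ_mem hP)
  have h1 : Tendsto (fun p : Ω × Y => g p.2 p.1) (𝓝 (ω₀, x)) (𝓝 (g x ω₀)) :=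
    hat.tendsto.comp (continuous_swap.tendsto (ω₀, x))
  have h2 : Tendsto (fun p : Ω × Y => g p.2 ω₀) (𝓝 (ω₀, x)) (𝓝 (g x ω₀)) :=
    hat.tendsto.comp ((continuous_snd.prodMk continuous_const).tendsto (ω₀, x))
  have h3 := (h1.sub h2).norm
  rw [sub_self, norm_zero] at h3
  exact h3.eventually (gt_mem_nhds hε)

theorem mainTheorem2 {N n m : ℕ} {Ω : Type*} [TopologicalSpace Ω]
    (P : Set Ω)
    (f : EuclideanSpace ℝ (Fin n) → EuclideanSpace ℝ (Fin m) → Ω → EuclideanSpace ℝ (Fin n))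
    (nbr : Fin N → Finset (Fin N)) (G : Fin N → Fin N → Matrix (Fin n) (Fin n) ℝ)
    (r : EuclideanSpace ℝ (Fin m))
    (hf_diff : ∀ ω ∈ P, Differentiable ℝ fun x => f x r ω)
    (hf_cont : ContinuousOn (fun q : EuclideanSpace ℝ (Fin n) × Ω => f q.1 r q.2) (univ ×ˢ P))
    (hf_fderiv : ContinuousOn
      (fun q : EuclideanSpace ℝ (Fin n) × Ω => fderiv ℝ (fun x => f x r q.2) q.1) (univ ×ˢ P))
    (ω₀ : Ω) (hω₀ : ω₀ ∈ interior P)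
    (K : Set (NetworkState N n)) (hK : IsConnected K)
    (M : NetworkState N n → NetworkState N n →L[ℝ] NetworkState N n →L[ℝ] ℝ)
    (lam : ℝ)
    (hTC : TransverseContracting (coupledField f nbr G r fun _ => ω₀) K M lam)
    (hne : ∀ x ∈ K, coupledField f nbr G r (fun _ => ω₀) x ≠ 0) :
    ∃ W : Set Ω, IsOpen W ∧ W ⊆ P ∧ ω₀ ∈ W ∧ ∃ lam' : ℝ, 0 < lam' ∧
      ∀ ω : Fin N → Ω, (∀ i, ω i ∈ W) →
        -- the heterogeneous network is transverse contracting on `K` under the same metric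
        TransverseContracting (coupledField f nbr G r ω) K M lam' ∧
        ConvergeUpToReparam (coupledField f nbr G r ω) K ∧
        (∀ x ∈ K, coupledField f nbr G r ω x ≠ 0) ∧
        -- solutions from `K` exist for all forward time and immediately enter the interior
        (∀ x₀ ∈ K, ∃ x : ℝ → NetworkState N n,
          IsForwardSolution (coupledField f nbr G r ω) x ∧ x 0 = x₀) ∧
        (∀ x : ℝ → NetworkState N n, IsForwardSolution (coupledField f nbr G r ω) x →
          x 0 ∈ K → ∀ t : ℝ, 0 < t → x t ∈ interior K) ∧
        -- there is exactly one limit cycle in `K`, and it attracts every solution from `K`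
        ∃ (O : Set (NetworkState N n)) (T : ℝ), 0 < T ∧
          IsPeriodicOrbit (coupledField f nbr G r ω) O T ∧ O ⊆ interior K ∧
          (∀ (O' : Set (NetworkState N n)) (T' : ℝ),
            IsPeriodicOrbit (coupledField f nbr G r ω) O' T' → O' ⊆ K → O' = O) ∧
          ∀ x : ℝ → NetworkState N n, IsForwardSolution (coupledField f nbr G r ω) x →
            x 0 ∈ K → Tendsto (fun t => Metric.infDist (x t) O) atTop (𝓝 0) := by
  have hf : ∀ ω ∈ P, ContDiff ℝ 1 fun x => f x r ω := fun ω hω =>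
    contDiff_one_iff_fderiv.2 ⟨hf_diff ω hω, hf_fderiv.comp_continuous
      (continuous_id.prodMk continuous_const) fun _ => ⟨mem_univ _, hω⟩⟩
  have hω₀P : ω₀ ∈ P := interior_subset hω₀
  have hF₀ := coupledField_contDiff nbr G (ω := fun _ : Fin N => ω₀) fun _ => hf ω₀ hω₀P
  obtain ⟨ε₁, hε₁, hrob⟩ := hTC.exists_robust hF₀
  obtain ⟨p, hp, hmin⟩ := hTC.isCompact.exists_isMinOn hK.nonempty hF₀.continuous.norm.continuousOn
  have hm : 0 < ‖coupledField f nbr G r (fun _ => ω₀) p‖ := norm_pos_iff.2 (hne p hp)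
  set ε₂ := ‖coupledField f nbr G r (fun _ => ω₀) p‖ with hε₂
  obtain ⟨C, hC, hdist⟩ := exists_norm_coupledField_sub_le N n
  set ε := min ε₁ (ε₂ / 2) / (C + 1) with hε_def
  have hε : 0 < ε := by positivity
  have hCε : C * ε ≤ min ε₁ (ε₂ / 2) := by
    have h1 : ε * (C + 1) = min ε₁ (ε₂ / 2) := div_mul_cancel₀ _ (by positivity)
    linarith
  set S : Set (EuclideanSpace ℝ (Fin n)) := ⋃ i : Fin N, (fun x : NetworkState N n => x i) '' K
  have hS : IsCompact S := isCompact_iUnion fun i => hTC.isCompact.image (by fun_prop)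
  have hmemS : ∀ x ∈ K, ∀ i, x i ∈ S := fun x hx i => mem_iUnion.2 ⟨i, x, hx, rfl⟩
  obtain ⟨W, hW, hWo, hωW⟩ := eventually_nhds_iff.1
    (((eventually_forall_norm_sub_lt (g := fun x ω => f x r ω) hf_cont hω₀ hS hε).and
      (eventually_forall_norm_sub_lt (g := fun x ω => fderiv ℝ (fun x => f x r ω) x) hf_fderiv hω₀
        hS hε)).and (mem_interior_iff_mem_nhds.1 hω₀))
  refine ⟨W, hWo, fun ω hω => (hW ω hω).2, hωW, lam / 4, by linarith [hTC.rate_pos],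
    fun ω hω => ?_⟩
  have hfω : ∀ i, ContDiff ℝ 1 fun x => f x r (ω i) := fun i => hf _ (hW _ (hω i)).2
  have hF := coupledField_contDiff nbr G hfω
  have hclose : ∀ x ∈ K, ‖coupledField f nbr G r ω x - coupledField f nbr G r (fun _ => ω₀) x‖ ≤
      min ε₁ (ε₂ / 2) := fun x hx =>
    ((hdist f r nbr G ω (fun _ => ω₀) hfω (fun _ => hf ω₀ hω₀P) x ε hε.le).1 fun i =>
      ((hW _ (hω i)).1.1 _ (hmemS x hx i)).le).trans hCε
  have hclose' : ∀ x ∈ K, ‖fderiv ℝ (coupledField f nbr G r ω) x -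
      fderiv ℝ (coupledField f nbr G r fun _ => ω₀) x‖ ≤ min ε₁ (ε₂ / 2) := fun x hx =>
    ((hdist f r nbr G ω (fun _ => ω₀) hfω (fun _ => hf ω₀ hω₀P) x ε hε.le).2 fun i =>
      ((hW _ (hω i)).1.2 _ (hmemS x hx i)).le).trans hCε
  have hT := hrob _ (fun x hx => (hclose x hx).trans (min_le_left _ _))
    fun x hx => (hclose' x hx).trans (min_le_left _ _)
  have hne' : ∀ x ∈ K, coupledField f nbr G r ω x ≠ 0 := fun x hx h0 => by
    have h1 := (hclose x hx).trans (min_le_right _ _)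
    rw [h0, zero_sub, norm_neg] at h1
    have h2 : ε₂ ≤ ‖coupledField f nbr G r (fun _ => ω₀) x‖ := hmin hx
    linarith
  exact ⟨hT, hT.convergeUpToReparam hF hK.isPreconnected, hne',
    fun x₀ hx₀ => hT.invariant.exists_isForwardSolution hT.isCompact hF hx₀,
    fun x hx hx0 t ht => hx.mem_interior_of_pos hT.invariant hT.isCompact.isClosed hx0 ht,
    hT.exists_unique_limitCycle hF hK hne'⟩
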